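/- Let $\mathcal D$ be the set of dyadic subintervals of $[0,1)$, i.e. the intervals $[k2^{-n},(k+1)2^{-n})$ with $n\ge 0$, $0\le k<2^n$, and let $|\cdot|$ be Lebesgue measure. For $\mathcal S\subseteq\mathcal D$ and $I\in\mathcal D$ put $A(\mathcal S,I)=\frac1{|I|}\sum_{J\in\mathcal S,\,J\subseteq I}|J|$. The number $A(\mathcal S,[0,1))$ is the Carleson height of $\mathcal S$, and $\mathcal S$ is a Carleson collection if $A(\mathcal S,I)\le 2$ for all $I\in\mathcal D$. Let $\mathcal A_{\mathcal S}g=\sum_{J\in\mathcal S}\big(\frac1{|J|}\int_J|g|\big)\mathbb 1_J$ (with values in $[0,\infty]$). For $(x,A,\lambda)\in[0,1]\times[0,2]\times\mathbb R$ let $$\mathbb B(x,A,\lambda)=\sup\big|\{t\in[0,1):\ \mathcal A_{\mathcal S}\mathbb 1_E(t)\ge\lambda\}\big|,$$ the supremum being taken over all measurable $E\subseteq[0,1)$ with $|E|=x$ and all Carleson collections $\mathcal S$ with Carleson height $A$. For integers $0\le k\le m$ let $F_k^m=\big(2^{-k},\,m-k+3-2^{-k}\big)$, and let $\Gamma_m$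 be the piecewise-linear curve $(0,0)\to F_m^m\to F_{m-1}^m\to\dots\to F_0^m$. It is the graph of a strictly increasing function $\gamma_m:[0,1]\to[0,m+2]$; let $\alpha_m:[0,m+2]\to[0,1]$ be its inverse. For $\lambda>0$ define $\mathbf f(\cdot,\lambda)$ on $[0,1]$ as follows. Put $\mathbf f(0,\lambda)=0$. For $0<x\le1$ let $m\ge0$ be the least integer with $\lambda\le\gamma_m(x)$, and put $$\mathbf f(x,\lambda)=\begin{cases}1 & \text{if } m=0,\\ 2^{-m} & \text{if } m\ge1 \text{ and } \lambda>m+1,\\ 2^{-m}+2^{-m}\,\dfrac{x-\alpha_m(\lambda)}{\alpha_{m-1}(\lambda)-\alpha_m(\lambda)} & \text{if } m\ge1\text{ and }\lambda\le m+1.\end{cases}$$ So $\mathbf f=2^{-m}$ on $\Gamma_m\setminus\{(0,0)\}$, and $\mathbf f$ interpolates linearly along horizontal lines between consecutive curves. Define $\mathbf B$ on $[0,1]\times[0,2]\times\mathbb R$ as follows. * If $\lambda\le0$, then $\mathbf B(x,A,\lambda)=1$. * If $0<\lambda\le1$, then $\mathbf B(x,A,\lambda)$ equals: $1$ if $(x,A)$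 lies in the polygon with vertices $(\frac\lambda2,2),(\lambda,1),(1,1),(1,2)$; $A$ if $(x,A)$ lies in the polygon with vertices $(0,0),(1,0),(1,1),(\lambda,1)$; $\frac13\big(A+\frac{2x}\lambda\big)$ if $(x,A)$ lies in the triangle with vertices $(0,0),(\lambda,1),(\frac\lambda2,2)$; $\frac A2\,\mathbf f\big(\frac{2x}A,\lambda\big)$ if $(x,A)$ lies in the triangle with vertices $(0,0),(\frac\lambda2,2),(0,2)$. (These four closed polygons cover $[0,1]\times[0,2]$, and the formulas agree on overlaps.) * If $\lambda>1$, then $\mathbf B(x,A,\lambda)=\frac A2\,\mathbf f\big(\frac{2x}A,\lambda\big)$ if $2x\le A$, and $\mathbf B(x,A,\lambda)=\frac A2\,\mathbf f(1,\lambda)$ if $2x>A$. (Expressions $\frac A2\,\mathbf f(\frac{2x}A,\lambda)$ with $A=0$ are read as $0$.) **Theorem.** $\mathbb B(x,A,\lambda)=\mathbf B(x,A,\lambda)$ for all $(x,A,\lambda)\in[0,1]\times[0,2]\times\mathbb R$. -/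

import Mathlib

open MeasureTheory Set
open scoped ENNReal

noncomputable section

namespace SparseBellman

/-! ### Dyadic intervals, Carleson sequences and sparse operators -/

/-- Labels of the dyadic subintervals of `[0,1)`: a generation `n` and a position `k < 2 ^ n`.
Different labels have different intervals, so a collection of dyadic intervals is a set of labels. -/
abbrev DyadicInt : Type := Σ n : ℕ, Fin (2 ^ n)

/-- The dyadic interval `[k / 2 ^ n, (k + 1) / 2 ^ n)`. -/
def DyadicInt.interval (I : DyadicInt) : Set ℝ :=
  Ico ((I.2 : ℝ) / 2 ^ I.1) (((I.2 : ℝ) + 1) / 2 ^ I.1)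

/-- The interval `[0,1)` itself. -/
def DyadicInt.unit : DyadicInt := ⟨0, ⟨0, by norm_num⟩⟩

/-- The sum of `α_J |J|` over all dyadic `J ⊆ I`, divided by `|I|`. -/
def carlesonHeight (α : DyadicInt → ℝ≥0∞) (I : DyadicInt) : ℝ≥0∞ :=
  (∑' J : {J : DyadicInt // J.interval ⊆ I.interval}, α J * volume J.1.interval) / volume I.interval

/-- The Carleson constant of a sequence: the supremum of its heights on all dyadic intervals. -/
def carlesonConst (α : DyadicInt → ℝ≥0∞) : ℝ≥0∞ := ⨆ I : DyadicInt, carlesonHeight α I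

/-- The binary sequence associated with a collection of dyadic intervals. -/
def binarySeq (S : Set DyadicInt) : DyadicInt → ℝ≥0∞ := S.indicator (fun _ => 1)

/-- A Carleson collection: its binary sequence has Carleson constant at most `2`. -/
def IsCarleson (S : Set DyadicInt) : Prop := carlesonConst (binarySeq S) ≤ 2

/-- The positive operator `∑_{J ∈ S} ⟨|f|⟩_J 1_J`. The value `∞` is allowed. -/
def sparseOp (S : Set DyadicInt) (f : ℝ → ℝ) (t : ℝ) : ℝ≥0∞ :=
  ∑' J : S, J.1.interval.indicator (fun _ => ⨍⁻ y in J.1.interval, ‖f y‖ₑ ∂volume) t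

/-- The set of `t ∈ [0,1)` at which the operator applied to `1_E` is at least `l`.
The operator is nonnegative, so for `l ≤ 0` (where `ENNReal.ofReal l = 0`) this is all of `[0,1)`. -/
def levelSet (S : Set DyadicInt) (E : Set ℝ) (l : ℝ) : Set ℝ :=
  {t ∈ Ico (0 : ℝ) 1 | ENNReal.ofReal l ≤ sparseOp S (E.indicator (fun _ => 1)) t}

/-- All values of `|{t ∈ [0,1) : 𝒜_S 1_E (t) ≥ l}|`, for Lebesgue measurable sets `E ⊆ [0,1)` of
measure `x` and Carleson collections `S` of Carleson height `A`. -/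
def bellmanValues (x A l : ℝ) : Set ℝ :=
  {v | ∃ (E : Set ℝ) (S : Set DyadicInt), NullMeasurableSet E volume ∧ E ⊆ Ico 0 1 ∧
    volume E = ENNReal.ofReal x ∧ IsCarleson S ∧
    carlesonHeight (binarySeq S) DyadicInt.unit = ENNReal.ofReal A ∧
    v = (volume (levelSet S E l)).toReal}

/-- The Bellman function. -/
def bellman (x A l : ℝ) : ℝ := sSup (bellmanValues x A l)

/-! ### The explicit function -/

/-- Linear interpolation `L[(x₁, y₁), (x₂, y₂)]`. -/
def lerp (x₁ y₁ x₂ y₂ x : ℝ) : ℝ := y₁ + (y₂ - y₁) / (x₂ - x₁) * (x - x₁)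

/-- The points `F_k^m = (2 ^ (-k), m - k + 3 - 2 ^ (-k))`, used for `0 ≤ k ≤ m`. -/
def F (m k : ℕ) : ℝ × ℝ := (1 / 2 ^ k, (m : ℝ) - k + 3 - 1 / 2 ^ k)

/-- The piecewise-linear curve `(0,0) → F_m^m → F_{m-1}^m → ⋯ → F_0^m` in the `(x, l)`-plane. -/
def Gam (m : ℕ) : Set (ℝ × ℝ) :=
  segment ℝ (0, 0) (F m m) ∪ ⋃ k ∈ Finset.range m, segment ℝ (F m (k + 1)) (F m k)

/-- The function on `[0,1]` whose graph is `Gam m`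
(for `0 ≤ x ≤ 1` exactly one point of the curve has abscissa `x`). -/
def gam (m : ℕ) (x : ℝ) : ℝ := sSup {l | (x, l) ∈ Gam m}

/-- The inverse function of `gam m` on `[0, m + 2]`: the abscissa of the point of `Gam m` at height
`l` (for `0 ≤ l ≤ m + 2` there is exactly one such point). -/
def alp (m : ℕ) (l : ℝ) : ℝ := sSup {x | (x, l) ∈ Gam m}

/-- The index of the lowest curve that passes through or above `(x, l)`: for `0 < x ≤ 1`, this is
`0` if `l ≤ gam 0 x`, and it is `m ≥ 1` if `gam (m - 1) x < l ≤ gam m x`. -/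
def strip (x l : ℝ) : ℕ := sInf {m : ℕ | l ≤ gam m x}

open Classical in
/-- The function `𝐟` on `[0,1] × (0,∞)`. With `m = strip x l`, the point `(x, l)` lies on `Gam m` or
between `Gam m` and `Gam (m - 1)`; the horizontal line at height `l` meets `Gam (m - 1)` exactly
when `l ≤ m + 1`, and otherwise there is no curve below. -/
def f (x l : ℝ) : ℝ :=
  if x = 0 then 0
  else if strip x l = 0 then 1
  else if (strip x l : ℝ) + 1 < l then 1 / 2 ^ strip x l
  else lerp (alp (strip x l) l) (1 / 2 ^ strip x l)
    (alp (strip x l - 1) l) (1 / 2 ^ (strip x l - 1)) x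

/-- The polygon with vertices `(l/2, 2), (l, 1), (1, 1), (1, 2)`. -/
def Sigma0' (l : ℝ) : Set (ℝ × ℝ) := convexHull ℝ {(l / 2, 2), (l, 1), (1, 1), (1, 2)}

/-- The polygon with vertices `(0, 0), (l, 1), (l/2, 2)`. -/
def Sigma0 (l : ℝ) : Set (ℝ × ℝ) := convexHull ℝ {(0, 0), (l, 1), (l / 2, 2)}

/-- The polygon with vertices `(0, 0), (1, 0), (1, 1), (l, 1)`. -/
def Sigma1 (l : ℝ) : Set (ℝ × ℝ) := convexHull ℝ {(0, 0), (1, 0), (1, 1), (l, 1)}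

open Classical in
/-- The explicit function `𝐁`. For `0 < l ≤ 1` the polygons `Sigma0' l`, `Sigma1 l`, `Sigma0 l` and
the triangle with vertices `(0, 0), (l/2, 2), (0, 2)` cover `[0,1] × [0,2]`, and the four formulas
agree where polygons meet; the last branch is that triangle. -/
def candidate (x A l : ℝ) : ℝ :=
  if l ≤ 0 then 1
  else if l ≤ 1 then
    if (x, A) ∈ Sigma0' l then 1
    else if (x, A) ∈ Sigma1 l then A
    else if (x, A) ∈ Sigma0 l then (A + 2 * x / l) / 3
    else A / 2 * f (2 * x / A) l
  else if 2 * x ≤ A then A / 2 * f (2 * x / A) l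
  else A / 2 * f 1 l

end SparseBellman

end

noncomputable section

namespace SparseBellman

/-! Split `[0,1)` into its two halves and rescale each to `[0,1)`. Measure, height and level-set
measure of a pair `(E, S)` are the averages of those of its halves, except that when `[0,1) ∈ S` the
height gains `1` and the operator gains the constant `|E| = x`; the halves are then tested at level
`λ - x` and have mean height `A - 1`. Hence the Bellman function is midpoint concave in `(x, A)`
(`bellman_midpoint`) and satisfies the jump inequality `B(x, A - 1, λ - x) ≤ B(x, A, λ)`
(`bellman_jump`).

Upper bound: a nonnegative function that equals `1` for `λ ≤ 0` and has both properties bounds the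
level sets of truncated operators, by induction on depth (`volume_levelSet_trunc_le`); left
semicontinuity in `λ` passes to the full operator (`le_of_mem_bellmanValues`). The work is to verify
the hypotheses for the explicit function: `candidate_midpoint`, through the supporting planes of
`candidate_support`, then `candidate_jump` and `eventually_candidate_le`.

All curves come from one concave function: `curve m x = profile (2 ^ m * x) - x`, so that `curve (m
+ 1) x = curve m (2 * x) + x`. Concavity of `profile` makes the slopes of `f` between consecutive
curves decrease in `x`, so `f` lies below each of its chords (`f_le_chord`). Together with `profile
(2 * y) = profile y + 1` for `y ≥ 1` it also yields the jump inequality for `f`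
(`half_f_two_mul_le`). Homogeneity reduces jumps at a general height to height `2` wherever the
explicit function is `A / 2 * f (2 * x / A)`.

Lower bound: a bounded midpoint concave function is concave (`bellman_concave`). Jumps, and
concentration of the height on a part of `[0,1)`, give the required values at the vertices of the
polygons and on the curves (`le_bellman_curve`); concavity fills in the rest (`f_le_bellman`,
`convexHull_subset_le_bellman`). -/

/-! ### Self-similarity of the dyadic tree. -/

/-- The left endpoint of the two halves of `[0,1)`, doubled. -/
def side (b : Bool) : ℝ := cond b 1 0

@[simp] lemma side_true : side true = 1 := rfl
@[simp] lemma side_false : side false = 0 := rfl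

/-- The map that expands one half of `[0,1)` to `[0,1)`. -/
def expand (b : Bool) (t : ℝ) : ℝ := 2 * t - side b

/-- The image of a dyadic interval under the contraction of `[0,1)` to one of its halves. -/
def child (b : Bool) (I : DyadicInt) : DyadicInt :=
  ⟨I.1 + 1, ⟨I.2 + b.toNat * 2 ^ I.1, by
    have := I.2.2
    cases b <;> simp [pow_succ] <;> omega⟩⟩

lemma interval_unit : DyadicInt.unit.interval = Ico 0 1 := by
  simp [DyadicInt.interval, DyadicInt.unit]

lemma interval_child (b : Bool) (I : DyadicInt) :
    (child b I).interval = expand b ⁻¹' I.interval := by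
  have h : (0 : ℝ) < 2 ^ I.1 := by positivity
  ext t
  simp only [DyadicInt.interval, child, expand, mem_preimage, mem_Ico]
  rw [div_le_iff₀ (by positivity), lt_div_iff₀ (by positivity), div_le_iff₀ h, lt_div_iff₀ h,
    pow_succ]
  cases b <;> simp <;> constructor <;> rintro ⟨h1, h2⟩ <;> constructor <;> linarith

lemma interval_subset_Ico (I : DyadicInt) : I.interval ⊆ Ico 0 1 := by
  intro t ht
  have h : (0 : ℝ) < 2 ^ I.1 := by positivity
  have h2 : ((I.2 : ℕ) : ℝ) + 1 ≤ 2 ^ I.1 := by exact_mod_cast I.2.2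
  obtain ⟨h3, h4⟩ := ht
  refine ⟨le_trans (by positivity) h3, h4.trans_le ?_⟩
  rw [div_le_one h]
  exact h2

lemma interval_nonempty (I : DyadicInt) : I.interval.Nonempty := by
  refine ⟨_, left_mem_Ico.2 ?_⟩
  gcongr
  linarith

lemma volume_interval (I : DyadicInt) : volume I.interval = ENNReal.ofReal (1 / 2 ^ I.1) := by
  rw [DyadicInt.interval, Real.volume_Ico]
  congr 1
  ring

lemma measurable_expand (b : Bool) : Measurable (expand b) := by
  unfold expand
  fun_prop

lemma volume_preimage_expand (b : Bool) (s : Set ℝ) :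
    volume (expand b ⁻¹' s) = volume s / 2 := by
  have : expand b ⁻¹' s = (fun t => 2 * t) ⁻¹' ((fun t => t - side b) ⁻¹' s) := rfl
  simp only [this, sub_eq_add_neg]
  rw [Real.volume_preimage_mul_left two_ne_zero, measure_preimage_add_right,
    ENNReal.div_eq_inv_mul, abs_of_pos (by norm_num), ENNReal.ofReal_inv_of_pos (by norm_num)]
  simp

lemma nullMeasurable_preimage_expand (b : Bool) {s : Set ℝ} (hs : NullMeasurableSet s volume) :
    NullMeasurableSet (expand b ⁻¹' s) volume := by
  refine hs.preimage ⟨measurable_expand b, ?_⟩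
  refine Measure.AbsolutelyContinuous.mk fun t ht h0 => ?_
  rw [Measure.map_apply (measurable_expand b) ht, volume_preimage_expand, h0]
  simp

lemma expand_leftInverse (b : Bool) (t : ℝ) : expand b ((t + side b) / 2) = t := by
  unfold expand
  ring

lemma expand_surjective (b : Bool) : Function.Surjective (expand b) :=
  fun t => ⟨_, expand_leftInverse b t⟩

lemma expand_mem_Ico_of_ne {b c : Bool} {t : ℝ} (hb : expand b t ∈ Ico (0 : ℝ) 1)
    (hc : expand c t ∈ Ico (0 : ℝ) 1) : b = c := by
  obtain ⟨h1, h2⟩ := hb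
  obtain ⟨h3, h4⟩ := hc
  cases b <;> cases c <;> simp [expand] at * <;> linarith

lemma exists_expand_mem_Ico {t : ℝ} (ht : t ∈ Ico (0 : ℝ) 1) :
    ∃ b, expand b t ∈ Ico (0 : ℝ) 1 := by
  obtain ⟨h1, h2⟩ := ht
  rcases lt_or_ge t (1 / 2) with h | h
  · exact ⟨false, by simp [expand]; constructor <;> linarith⟩
  · exact ⟨true, by simp [expand]; constructor <;> linarith⟩

lemma mem_Ico_of_expand {b : Bool} {t : ℝ} (ht : expand b t ∈ Ico (0 : ℝ) 1) :
    t ∈ Ico (0 : ℝ) 1 := by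
  obtain ⟨h1, h2⟩ := ht
  cases b <;> simp [expand] at * <;> constructor <;> linarith

lemma child_injective : Function.Injective fun p : Bool × DyadicInt => child p.1 p.2 := by
  rintro ⟨b, n, k⟩ ⟨c, m, j⟩ h
  simp only [child] at h
  obtain ⟨h1, h2⟩ := Sigma.mk.inj_iff.1 h
  obtain rfl : n = m := by omega
  have h3 := congrArg Fin.val (eq_of_heq h2)
  have hk := k.2
  have hj := j.2
  cases b <;> cases c <;> simp at h3 ⊢ <;> first | exact Fin.ext h3 | omega

lemma eq_unit_or_child (J : DyadicInt) : J = DyadicInt.unit ∨ ∃ b I, J = child b I := by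
  obtain ⟨n, k⟩ := J
  cases n with
  | zero =>
    left
    simp only [DyadicInt.unit]
    congr 1
    exact Fin.ext (by have := k.2; simp at this ⊢)
  | succ n =>
    right
    have hk : (k : ℕ) < 2 ^ n * 2 := pow_succ 2 n ▸ k.2
    rcases lt_or_ge (k : ℕ) (2 ^ n) with h | h
    · exact ⟨false, ⟨n, ⟨k, h⟩⟩, by simp [child]⟩
    · refine ⟨true, ⟨n, ⟨k - 2 ^ n, by omega⟩⟩, ?_⟩
      simp only [child]
      congr 1
      exact Fin.ext (by simp; omega)

lemma unit_ne_child (b : Bool) (I : DyadicInt) : DyadicInt.unit ≠ child b I := by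
  intro h
  have := congrArg Sigma.fst h
  simp [DyadicInt.unit, child] at this

lemma sumElim_bijective : Function.Bijective
    (Sum.elim (fun _ : Unit => DyadicInt.unit) fun p : Bool × DyadicInt => child p.1 p.2) := by
  constructor
  · rintro (_ | p) (_ | q) h
    · rfl
    · exact absurd h (unit_ne_child _ _)
    · exact absurd h.symm (unit_ne_child _ _)
    · exact congrArg _ (child_injective h)
  · intro J
    rcases eq_unit_or_child J with rfl | ⟨b, I, rfl⟩
    · exact ⟨Sum.inl (), rfl⟩
    · exact ⟨Sum.inr (b, I), rfl⟩

/-- Every label is the root or a child of exactly one label on exactly one side. All the recursions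
for heights and operators are instances of this splitting. -/
lemma tsum_dyadic (g : DyadicInt → ℝ≥0∞) :
    ∑' J, g J = g DyadicInt.unit + ∑ b, ∑' I, g (child b I) := by
  have h := Summable.tsum_sum
    (f := fun o => g (Sum.elim (fun _ : Unit => DyadicInt.unit)
      (fun p : Bool × DyadicInt => child p.1 p.2) o)) ENNReal.summable ENNReal.summable
  rw [← (Equiv.ofBijective _ sumElim_bijective).tsum_eq]
  refine h.trans ?_
  congr 1
  · simp
  · exact (ENNReal.tsum_prod (f := fun b I => g (child b I))).trans (tsum_fintype _)

lemma child_subset_child {b c : Bool} {I J : DyadicInt} :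
    (child b J).interval ⊆ (child c I).interval ↔ b = c ∧ J.interval ⊆ I.interval := by
  simp only [interval_child]
  constructor
  · intro h
    have hbc : b = c := by
      obtain ⟨t, ht⟩ := interval_nonempty J
      have h1 : (t + side b) / 2 ∈ expand b ⁻¹' J.interval := by
        rwa [mem_preimage, expand_leftInverse]
      exact expand_mem_Ico_of_ne (interval_subset_Ico _ h1) (interval_subset_Ico _ (h h1))
    subst hbc
    exact ⟨rfl, (expand_surjective b).preimage_subset_preimage_iff.1 h⟩
  · rintro ⟨rfl, h⟩
    exact preimage_mono h

lemma unit_not_subset_child (b : Bool) (I : DyadicInt) :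
    ¬ DyadicInt.unit.interval ⊆ (child b I).interval := by
  rw [interval_unit, interval_child]
  intro h
  have h1 := interval_subset_Ico _ (h (show (0 : ℝ) ∈ Ico (0 : ℝ) 1 by norm_num))
  have h2 := interval_subset_Ico _ (h (show (1 / 2 : ℝ) ∈ Ico (0 : ℝ) 1 by norm_num))
  cases b
  · norm_num [expand] at h2
  · norm_num [expand] at h1

lemma volume_child (b : Bool) (I : DyadicInt) :
    volume (child b I).interval = volume I.interval / 2 := by
  rw [interval_child, volume_preimage_expand]

lemma half_div_half (a b : ℝ≥0∞) : a / 2 / (b / 2) = a / b := by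
  rw [ENNReal.div_eq_inv_mul, ENNReal.div_eq_inv_mul, ENNReal.div_eq_inv_mul,
    ENNReal.div_eq_inv_mul, ENNReal.mul_inv (by simp) (by simp), inv_inv, mul_mul_mul_comm,
    ENNReal.mul_inv_cancel (by simp) (by simp), one_mul]

/-! ### Heights, operators and level sets in terms of the two halves. -/

open Classical in
lemma carlesonHeight_eq (S : Set DyadicInt) (I : DyadicInt) :
    carlesonHeight (binarySeq S) I =
      (∑' J : DyadicInt, if J.interval ⊆ I.interval ∧ J ∈ S then volume J.interval else 0) /
        volume I.interval := by
  rw [carlesonHeight]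
  refine congrArg (· / _) ((tsum_subtype {J : DyadicInt | J.interval ⊆ I.interval}
    fun J => binarySeq S J * volume J.interval).trans ?_)
  congr 1
  ext J
  by_cases h1 : J.interval ⊆ I.interval <;> by_cases h2 : J ∈ S <;> simp [h1, h2, binarySeq]

/-- The part of a collection that lies in one half of `[0,1)`, rescaled to `[0,1)`. -/
def half (S : Set DyadicInt) (b : Bool) : Set DyadicInt := child b ⁻¹' S

lemma carlesonHeight_child (S : Set DyadicInt) (b : Bool) (I : DyadicInt) :
    carlesonHeight (binarySeq S) (child b I) = carlesonHeight (binarySeq (half S b)) I := by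
  classical
  rw [carlesonHeight_eq, carlesonHeight_eq, tsum_dyadic, volume_child]
  have key : ∀ c, (∑' J, if (child c J).interval ⊆ (child b I).interval ∧ child c J ∈ S then
      volume (child c J).interval else 0) = if c = b then
      (∑' J : DyadicInt, if J.interval ⊆ I.interval ∧ J ∈ half S b then volume J.interval else 0) / 2
      else 0 := by
    intro c
    simp only [child_subset_child, volume_child]
    by_cases h : c = b
    · subst h
      simp only [true_and, if_true, ENNReal.div_eq_inv_mul, ← ENNReal.tsum_mul_left]
      congr 1
      ext J
      simp only [half, mem_preimage]
      split_ifs <;> simp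
    · simp [h]
  simp only [key, unit_not_subset_child, false_and, if_false, zero_add]
  rw [Finset.sum_ite_eq' Finset.univ b, if_pos (Finset.mem_univ _)]
  exact half_div_half _ _

-- The root contributes its own length `1`; an interval inside a half has half its rescaled length,
-- which turns the sum over both halves into an average.
open Classical in
lemma carlesonHeight_unit (S : Set DyadicInt) :
    carlesonHeight (binarySeq S) DyadicInt.unit = (if DyadicInt.unit ∈ S then 1 else 0) +
      (∑ b, carlesonHeight (binarySeq (half S b)) DyadicInt.unit) / 2 := by
  simp only [carlesonHeight_eq, interval_unit, interval_subset_Ico, true_and]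
  rw [tsum_dyadic]
  simp only [Real.volume_Ico, sub_zero, ENNReal.ofReal_one, div_one, interval_unit, volume_child]
  congr 1
  rw [ENNReal.div_eq_inv_mul, Finset.mul_sum]
  congr 1
  ext b
  rw [← ENNReal.tsum_mul_left]
  congr 1
  ext J
  simp only [half, mem_preimage, ENNReal.div_eq_inv_mul]
  split_ifs <;> simp

lemma isCarleson_iff (S : Set DyadicInt) :
    IsCarleson S ↔ carlesonHeight (binarySeq S) DyadicInt.unit ≤ 2 ∧ ∀ b, IsCarleson (half S b) := by
  simp only [IsCarleson, carlesonConst, iSup_le_iff, ← carlesonHeight_child]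
  constructor
  · exact fun h => ⟨h _, fun b I => h _⟩
  · rintro ⟨h1, h2⟩ J
    rcases eq_unit_or_child J with rfl | ⟨b, I, rfl⟩
    · exact h1
    · exact h2 b I

/-- Puts the operator in the form of a sum over all labels, with averages written as ratios of
measures, so that `tsum_dyadic` applies. -/
lemma sparseOp_indicator (S : Set DyadicInt) {E : Set ℝ} (hE : NullMeasurableSet E volume) (t : ℝ) :
    sparseOp S (E.indicator fun _ => 1) t = ∑' J : DyadicInt, S.indicator (fun J =>
      J.interval.indicator (fun _ => volume (E ∩ J.interval) / volume J.interval) t) J := by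
  rw [sparseOp, tsum_subtype S fun J : DyadicInt => J.interval.indicator
    (fun _ => ⨍⁻ y in J.interval, ‖E.indicator (fun _ => (1 : ℝ)) y‖ₑ ∂volume) t]
  have : ∀ J : DyadicInt, (⨍⁻ y in J.interval, ‖E.indicator (fun _ => (1 : ℝ)) y‖ₑ ∂volume) =
      volume (E ∩ J.interval) / volume J.interval := by
    intro J
    rw [setLAverage_eq]
    congr 1
    have h : (fun y => ‖E.indicator (fun _ => (1 : ℝ)) y‖ₑ) = E.indicator 1 := by
      ext y
      by_cases hy : y ∈ E <;> simp [hy]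
    rw [h, lintegral_indicator_one₀ (hE.mono_ac Measure.restrict_le_self.absolutelyContinuous),
      Measure.restrict_apply₀ (hE.mono_ac Measure.restrict_le_self.absolutelyContinuous)]
  simp only [this]

/-- The part of a subset of `[0,1)` in one of the halves, rescaled to `[0,1)`. -/
def halfSet (E : Set ℝ) (b : Bool) : Set ℝ := {t ∈ Ico (0 : ℝ) 1 | (t + side b) / 2 ∈ E}

lemma preimage_expand_halfSet (E : Set ℝ) (b : Bool) :
    expand b ⁻¹' halfSet E b = E ∩ expand b ⁻¹' Ico 0 1 := by
  ext t
  have : (expand b t + side b) / 2 = t := by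
    unfold expand
    ring
  simp only [halfSet, mem_preimage, mem_ofPred_eq, this, mem_inter_iff]
  tauto

lemma halfSet_subset (E : Set ℝ) (b : Bool) : halfSet E b ⊆ Ico 0 1 := fun _ h => h.1

lemma nullMeasurable_halfSet {E : Set ℝ} (hE : NullMeasurableSet E volume) (b : Bool) :
    NullMeasurableSet (halfSet E b) volume := by
  have : halfSet E b = Ico 0 1 ∩ (fun t => (t + side b) / 2) ⁻¹' E := rfl
  rw [this]
  refine measurableSet_Ico.nullMeasurableSet.inter (hE.preimage ⟨by fun_prop, ?_⟩)
  refine Measure.AbsolutelyContinuous.mk fun t ht h0 => ?_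
  rw [Measure.map_apply (by fun_prop) ht]
  have h1 : (fun t => (t + side b) / 2) ⁻¹' t =
      (fun t => t * 2⁻¹) ⁻¹' ((fun t => t + side b / 2) ⁻¹' t) := by
    ext y
    simp only [mem_preimage, div_eq_mul_inv, add_mul]
  rw [h1, Real.volume_preimage_mul_right (by norm_num), measure_preimage_add_right, h0, mul_zero]

lemma volume_halfSet_inter (E : Set ℝ) (b : Bool) (J : DyadicInt) :
    volume (E ∩ (child b J).interval) = volume (halfSet E b ∩ J.interval) / 2 := by
  rw [← volume_preimage_expand b, preimage_inter, preimage_expand_halfSet, interval_child,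
    inter_assoc, inter_eq_right.2 (preimage_mono (interval_subset_Ico J))]

/-- Sets are split by the two halves of `[0,1)`. -/
lemma volume_eq_sum_halves {X : Set ℝ} (hX : X ⊆ Ico 0 1) :
    volume X = (∑ b, volume (halfSet X b)) / 2 := by
  have h : ∀ b, volume (halfSet X b) / 2 = volume (X ∩ expand b ⁻¹' Ico 0 1) := by
    intro b
    rw [← volume_preimage_expand b, preimage_expand_halfSet]
  rw [Fintype.sum_bool, ENNReal.add_div, h, h,
    ← measure_inter_add_sdiff X (measurable_expand true measurableSet_Ico)]
  congr 2
  ext t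
  simp only [mem_sdiff, mem_inter_iff, and_congr_right_iff]
  intro ht
  constructor
  · intro h1
    obtain ⟨b, hb⟩ := exists_expand_mem_Ico (hX ht)
    cases b
    · exact hb
    · exact absurd hb h1
  · intro h1 h2
    exact absurd (expand_mem_Ico_of_ne h1 h2) (by simp)

-- The root adds the constant `|E|`; the half not containing `t` adds nothing; in the other half
-- averages do not change under rescaling.
open Classical in
lemma sparseOp_expand (S : Set DyadicInt) {E : Set ℝ} (hE : NullMeasurableSet E volume)
    (hE1 : E ⊆ Ico 0 1) {b : Bool} {t : ℝ} (ht : expand b t ∈ Ico (0 : ℝ) 1) :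
    sparseOp S (E.indicator fun _ => 1) t = (if DyadicInt.unit ∈ S then volume E else 0) +
      sparseOp (half S b) ((halfSet E b).indicator fun _ => 1) (expand b t) := by
  rw [sparseOp_indicator S hE, sparseOp_indicator _ (nullMeasurable_halfSet hE b), tsum_dyadic]
  congr 1
  · simp only [indicator, interval_unit, mem_Ico_of_expand ht, if_true, inter_eq_left.2 hE1]
    simp
  · have key : ∀ c ≠ b, (∑' I, S.indicator (fun J => J.interval.indicator
        (fun _ => volume (E ∩ J.interval) / volume J.interval) t) (child c I)) = 0 := by
      intro c hc
      rw [ENNReal.tsum_eq_zero]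
      intro I
      have : t ∉ (child c I).interval := by
        rw [interval_child]
        exact fun h => hc (expand_mem_Ico_of_ne (interval_subset_Ico _ h) ht)
      simp [indicator, this]
    rw [Finset.sum_eq_single b (fun c _ hc => key c hc) (by simp)]
    congr 1
    ext I
    simp only [indicator, half, mem_preimage, volume_halfSet_inter, volume_child, half_div_half]
    simp only [interval_child, mem_preimage]

lemma halfSet_levelSet (S : Set DyadicInt) {E : Set ℝ} (hE : NullMeasurableSet E volume)
    (hE1 : E ⊆ Ico 0 1) {x : ℝ} (hx : 0 ≤ x) (hEx : volume E = ENNReal.ofReal x) (l : ℝ) (b : Bool)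
    [Decidable (DyadicInt.unit ∈ S)] :
    halfSet (levelSet S E l) b = levelSet (half S b) (halfSet E b)
      (l - if DyadicInt.unit ∈ S then x else 0) := by
  ext t
  simp only [halfSet, levelSet, mem_ofPred_eq]
  refine and_congr_right fun ht => ?_
  have h1 : expand b ((t + side b) / 2) = t := expand_leftInverse b t
  have h2 : expand b ((t + side b) / 2) ∈ Ico (0 : ℝ) 1 := by rwa [h1]
  rw [sparseOp_expand S hE hE1 h2, h1, and_iff_right (mem_Ico_of_expand h2), hEx]
  change _ ↔ _ ≤ sparseOp (half S b) ((halfSet E b).indicator fun _ => 1) t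
  -- `l - x` may be negative: the truncation in `ENNReal.ofReal` agrees with truncated subtraction.
  split_ifs
  · rw [ENNReal.ofReal_sub _ hx, tsub_le_iff_left]
  · simp

lemma levelSet_subset (S : Set DyadicInt) (E : Set ℝ) (l : ℝ) : levelSet S E l ⊆ Ico 0 1 :=
  fun _ h => h.1

/-! ### Gluing two configurations into one. -/

/-- The collection with prescribed halves, with or without `[0,1)`. -/
def glue (top : Prop) (S : Bool → Set DyadicInt) : Set DyadicInt :=
  {J | (J = DyadicInt.unit ∧ top) ∨ ∃ b, ∃ I ∈ S b, J = child b I}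

lemma unit_mem_glue (top : Prop) (S : Bool → Set DyadicInt) :
    DyadicInt.unit ∈ glue top S ↔ top := by
  simp [glue, unit_ne_child]

lemma half_glue (top : Prop) (S : Bool → Set DyadicInt) (b : Bool) : half (glue top S) b = S b := by
  ext I
  constructor
  · rintro (⟨h, -⟩ | ⟨c, J, hJ, h⟩)
    · exact absurd h.symm (unit_ne_child b I)
    · obtain ⟨rfl, rfl⟩ := Prod.mk_inj.1 (child_injective (a₁ := (b, I)) (a₂ := (c, J)) h)
      exact hJ
  · exact fun h => Or.inr ⟨b, I, h, rfl⟩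

/-- The subset of `[0,1)` with prescribed halves. -/
def glueSet (E : Bool → Set ℝ) : Set ℝ := ⋃ b, expand b ⁻¹' E b

lemma halfSet_glueSet {E : Bool → Set ℝ} (hE : ∀ b, E b ⊆ Ico 0 1) (b : Bool) :
    halfSet (glueSet E) b = E b := by
  ext t
  simp only [halfSet, glueSet, mem_ofPred_eq, mem_iUnion, mem_preimage]
  constructor
  · rintro ⟨ht, c, hc⟩
    have h1 : expand b ((t + side b) / 2) = t := expand_leftInverse b t
    obtain rfl : b = c := expand_mem_Ico_of_ne (by rwa [h1]) (hE c hc)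
    rwa [h1] at hc
  · intro ht
    exact ⟨hE b ht, b, by rwa [expand_leftInverse]⟩

lemma glueSet_subset {E : Bool → Set ℝ} (hE : ∀ b, E b ⊆ Ico 0 1) : glueSet E ⊆ Ico 0 1 :=
  iUnion_subset fun b _ ht => mem_Ico_of_expand (hE b ht)

lemma volume_ne_top_of_subset {X : Set ℝ} (hX : X ⊆ Ico 0 1) : volume X ≠ ∞ :=
  ((measure_mono hX).trans_lt (by simp)).ne

lemma toReal_volume_le_one {X : Set ℝ} (hX : X ⊆ Ico 0 1) : (volume X).toReal ≤ 1 := by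
  refine ENNReal.toReal_le_of_le_ofReal zero_le_one ?_
  simpa using measure_mono (μ := volume) hX

lemma toReal_volume_eq_sum_halves {X : Set ℝ} (hX : X ⊆ Ico 0 1) :
    (volume X).toReal = ((volume (halfSet X true)).toReal + (volume (halfSet X false)).toReal) / 2 := by
  rw [volume_eq_sum_halves hX, ENNReal.toReal_div, Fintype.sum_bool, ENNReal.toReal_add
    (volume_ne_top_of_subset (halfSet_subset _ _)) (volume_ne_top_of_subset (halfSet_subset _ _))]
  simp

-- The converse of splitting, and the source of both inequalities for the Bellman function: without
-- the root it gives midpoint concavity, with the root the jump.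
open Classical in
lemma glue_mem_bellmanValues {top : Prop} {x A v : Bool → ℝ} {l : ℝ} (hx : ∀ b, 0 ≤ x b)
    (hA : ∀ b, 0 ≤ A b) (hA2 : (if top then 1 else 0) + (A true + A false) / 2 ≤ 2)
    (hv : ∀ b, v b ∈ bellmanValues (x b) (A b)
      (l - if top then (x true + x false) / 2 else 0)) :
    (v true + v false) / 2 ∈ bellmanValues ((x true + x false) / 2)
      ((if top then 1 else 0) + (A true + A false) / 2) l := by
  choose E S hE1 hE2 hE3 hS1 hS2 hv using hv
  have hEx : volume (glueSet E) = ENNReal.ofReal ((x true + x false) / 2) := by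
    rw [volume_eq_sum_halves (glueSet_subset hE2)]
    simp only [halfSet_glueSet hE2, Fintype.sum_bool, hE3]
    rw [← ENNReal.ofReal_add (hx _) (hx _), ENNReal.ofReal_div_of_pos two_pos]
    simp
  have hnull : NullMeasurableSet (glueSet E) volume :=
    NullMeasurableSet.iUnion fun b => nullMeasurable_preimage_expand b (hE1 b)
  have hheight : carlesonHeight (binarySeq (glue top S)) DyadicInt.unit =
      ENNReal.ofReal ((if top then 1 else 0) + (A true + A false) / 2) := by
    rw [carlesonHeight_unit]
    simp only [unit_mem_glue, half_glue, Fintype.sum_bool, hS2]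
    rw [ENNReal.ofReal_add (by split_ifs <;> norm_num) (by have := hA true; have := hA false; positivity),
      ← ENNReal.ofReal_add (hA _) (hA _), ENNReal.ofReal_div_of_pos two_pos]
    congr 1
    · split_ifs <;> simp
    · simp
  refine ⟨glueSet E, glue top S, hnull, glueSet_subset hE2, hEx, ?_, hheight, ?_⟩
  · rw [isCarleson_iff, hheight]
    refine ⟨?_, fun b => by rw [half_glue]; exact hS1 b⟩
    exact ENNReal.ofReal_le_of_le_toReal (by simpa using hA2)
  · have h : ∀ b, halfSet (levelSet (glue top S) (glueSet E) l) b =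
        levelSet (S b) (E b) (l - if top then (x true + x false) / 2 else 0) := by
      intro b
      rw [halfSet_levelSet _ hnull (glueSet_subset hE2)
        (by have := hx true; have := hx false; positivity) hEx, half_glue, halfSet_glueSet hE2]
      simp only [unit_mem_glue]
    rw [toReal_volume_eq_sum_halves (levelSet_subset _ _ _), h, h, hv, hv]

lemma bellmanValues_le_one {x A l v : ℝ} (hv : v ∈ bellmanValues x A l) : v ≤ 1 := by
  obtain ⟨E, S, -, -, -, -, -, rfl⟩ := hv
  exact toReal_volume_le_one (levelSet_subset _ _ _)

lemma bellmanValues_nonneg {x A l v : ℝ} (hv : v ∈ bellmanValues x A l) : 0 ≤ v := by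
  obtain ⟨E, S, -, -, -, -, -, rfl⟩ := hv
  exact ENNReal.toReal_nonneg

lemma bddAbove_bellmanValues (x A l : ℝ) : BddAbove (bellmanValues x A l) :=
  ⟨1, fun _ => bellmanValues_le_one⟩

/-! ### Every height in `[0,2]` occurs. -/

/-- The interval `[0, 2 ^ (-n))`. -/
def initial (n : ℕ) : DyadicInt := ⟨n, ⟨0, by positivity⟩⟩

lemma initial_injective : Function.Injective initial := fun _ _ h => congrArg Sigma.fst h

lemma zero_mem_interval_initial (n : ℕ) : (0 : ℝ) ∈ (initial n).interval := by
  simp [DyadicInt.interval, initial]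

lemma eq_initial_of_zero_mem {I : DyadicInt} (h : (0 : ℝ) ∈ I.interval) : I = initial I.1 := by
  obtain ⟨n, k⟩ := I
  simp only [initial]
  congr 1
  have h1 := h.1
  simp only at h1
  rw [div_le_iff₀ (by positivity), zero_mul] at h1
  have h2 : (k : ℕ) = 0 := by exact_mod_cast le_antisymm h1 (by positivity)
  exact Fin.ext h2

lemma initial_subset_iff {m n : ℕ} : (initial m).interval ⊆ (initial n).interval ↔ n ≤ m := by
  have h2 : ∀ n, (initial n).interval = Ico 0 (1 / 2 ^ n) := by
    intro n
    simp [DyadicInt.interval, initial]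
  rw [h2, h2, Ico_subset_Ico_iff (by positivity), one_div_le_one_div (by positivity) (by positivity)]
  simp [pow_le_pow_iff_right₀]

/-- Heights of a collection of intervals with left endpoint `0`. -/
lemma carlesonHeight_initial (d : ℕ → Fin 2) (n : ℕ) :
    carlesonHeight (binarySeq (initial '' {k | d k = 1})) (initial n) =
      ENNReal.ofReal (2 * Real.ofDigits fun k => d (k + n)) := by
  classical
  rw [carlesonHeight_eq, volume_interval]
  have h1 : (∑' J : DyadicInt, if J.interval ⊆ (initial n).interval ∧ J ∈ initial '' {k | d k = 1}
      then volume J.interval else 0) =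
      ∑' k, if n ≤ k ∧ d k = 1 then ENNReal.ofReal (1 / 2 ^ k) else 0 := by
    rw [← initial_injective.tsum_eq]
    · congr 1
      ext k
      simp only [initial_subset_iff, initial_injective.mem_set_image, mem_ofPred_eq, volume_interval]
      rfl
    · intro J hJ
      simp only [Function.mem_support, ne_eq, ite_eq_right_iff, not_forall] at hJ
      obtain ⟨⟨-, k, -, hk⟩, -⟩ := hJ
      exact ⟨k, hk⟩
  -- `Real.ofDigits` gives digit `k` the weight `2 ^ (-(k + 1))`, whence the factor `2`; the index
  -- shift by `n` factors out the length of `initial n`.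
  have h2 : (∑' k, if n ≤ k ∧ d k = 1 then ENNReal.ofReal (1 / 2 ^ k) else 0) =
      ∑' k, ENNReal.ofReal (1 / 2 ^ n) * ENNReal.ofReal (2 * Real.ofDigitsTerm (fun k => d (k + n)) k) := by
    rw [← (add_left_injective n).tsum_eq]
    · congr 1
      ext k
      rw [← ENNReal.ofReal_mul (by positivity)]
      simp only [le_add_iff_nonneg_left, zero_le, true_and, Real.ofDigitsTerm]
      have : d (k + n) = 0 ∨ d (k + n) = 1 := by omega
      rcases this with h | h
      · simp [h]
      · simp only [h, if_true]
        congr 1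
        simp only [Fin.val_one, Nat.cast_one, Nat.cast_ofNat]
        field_simp
        ring
    · intro k hk
      simp only [Function.mem_support, ne_eq, ite_eq_right_iff, not_forall] at hk
      obtain ⟨⟨h, -⟩, -⟩ := hk
      exact ⟨k - n, by simp; omega⟩
  rw [h1, h2, ENNReal.tsum_mul_left, ← ENNReal.ofReal_tsum_of_nonneg
    (fun k => mul_nonneg zero_le_two Real.ofDigitsTerm_nonneg) (Real.summable_ofDigitsTerm.mul_left 2),
    tsum_mul_left, ENNReal.mul_div_right_comm]
  change ENNReal.ofReal (1 / 2 ^ n) / ENNReal.ofReal (1 / 2 ^ n) * _ = _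
  rw [ENNReal.div_self (by simp) ENNReal.ofReal_ne_top, one_mul]
  rfl

/-- The binary digits of `A / 2` decide which intervals `[0, 2 ^ (-n))` are taken. Local heights are
then `0` away from the origin, and twice the value of a tail of the expansion, hence at most `2`, at
the origin. -/
lemma exists_isCarleson {A : ℝ} (hA : A ∈ Icc (0 : ℝ) 2) : ∃ S, IsCarleson S ∧
    carlesonHeight (binarySeq S) DyadicInt.unit = ENNReal.ofReal A := by
  obtain ⟨d, -, hd⟩ := Real.ofDigits_SurjOn (b := 2) one_lt_two
    (show A / 2 ∈ Icc (0 : ℝ) 1 from ⟨by linarith [hA.1], by linarith [hA.2]⟩)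
  refine ⟨initial '' {k | d k = 1}, iSup_le fun I => ?_, ?_⟩
  · by_cases h : (0 : ℝ) ∈ I.interval
    · rw [eq_initial_of_zero_mem h, carlesonHeight_initial]
      refine ENNReal.ofReal_le_of_le_toReal ?_
      have := Real.ofDigits_le_one (fun k => d (k + I.1))
      simp
      linarith
    · classical
      rw [carlesonHeight_eq]
      have : (∑' J : DyadicInt, if J.interval ⊆ I.interval ∧ J ∈ initial '' {k | d k = 1} then
          volume J.interval else 0) = 0 := by
        rw [ENNReal.tsum_eq_zero]
        intro J
        rw [if_neg]
        rintro ⟨h1, k, -, rfl⟩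
        exact h (h1 (zero_mem_interval_initial k))
      rw [this]
      simp
  · have := carlesonHeight_initial d 0
    simp only [add_zero, hd, mul_div_cancel₀ A two_ne_zero] at this
    exact this

lemma bellmanValues_nonempty {x A : ℝ} (hx : x ∈ Icc (0 : ℝ) 1) (hA : A ∈ Icc (0 : ℝ) 2) (l : ℝ) :
    (bellmanValues x A l).Nonempty := by
  obtain ⟨S, hS, hS2⟩ := exists_isCarleson hA
  exact ⟨_, Ico 0 x, S, measurableSet_Ico.nullMeasurableSet, Ico_subset_Ico_right hx.2, by simp,
    hS, hS2, rfl⟩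

/-! ### Midpoint concavity and jump inequality for the Bellman function. -/

lemma bellman_nonneg (x A l : ℝ) : 0 ≤ bellman x A l :=
  Real.sSup_nonneg fun _ => bellmanValues_nonneg

lemma bellman_le_one (x A l : ℝ) : bellman x A l ≤ 1 :=
  Real.sSup_le (fun _ => bellmanValues_le_one) zero_le_one

lemma bellman_of_nonpos {x A l : ℝ} (hx : x ∈ Icc (0 : ℝ) 1) (hA : A ∈ Icc (0 : ℝ) 2)
    (hl : l ≤ 0) : bellman x A l = 1 := by
  have h : ∀ v ∈ bellmanValues x A l, v = 1 := by
    rintro v ⟨E, S, -, -, -, -, -, rfl⟩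
    have : levelSet S E l = Ico 0 1 := by
      ext t
      simp [levelSet, ENNReal.ofReal_of_nonpos hl]
    simp [this]
  obtain ⟨v, hv⟩ := bellmanValues_nonempty hx hA l
  refine le_antisymm (bellman_le_one _ _ _) ?_
  rw [← h v hv]
  exact le_csSup (bddAbove_bellmanValues _ _ _) hv

lemma bellman_antitone {x A l l' : ℝ} (h : l ≤ l') (hx : x ∈ Icc (0 : ℝ) 1)
    (hA : A ∈ Icc (0 : ℝ) 2) : bellman x A l' ≤ bellman x A l := by
  refine csSup_le (bellmanValues_nonempty hx hA l') ?_
  rintro v ⟨E, S, h1, h2, h3, h4, h5, rfl⟩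
  refine le_trans ?_ (le_csSup (bddAbove_bellmanValues _ _ _) ⟨E, S, h1, h2, h3, h4, h5, rfl⟩)
  refine ENNReal.toReal_mono (volume_ne_top_of_subset (levelSet_subset _ _ _)) (measure_mono ?_)
  exact fun t ht => ⟨ht.1, (ENNReal.ofReal_le_ofReal h).trans ht.2⟩

lemma bellman_midpoint {x y A B l : ℝ} (hx : x ∈ Icc (0 : ℝ) 1) (hy : y ∈ Icc (0 : ℝ) 1)
    (hA : A ∈ Icc (0 : ℝ) 2) (hB : B ∈ Icc (0 : ℝ) 2) :
    (bellman x A l + bellman y B l) / 2 ≤ bellman ((x + y) / 2) ((A + B) / 2) l := by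
  have key : ∀ v ∈ bellmanValues x A l, ∀ w ∈ bellmanValues y B l,
      (v + w) / 2 ≤ bellman ((x + y) / 2) ((A + B) / 2) l := by
    intro v hv w hw
    refine le_csSup (bddAbove_bellmanValues _ _ _) ?_
    have := glue_mem_bellmanValues (top := False) (x := fun b => cond b x y)
      (A := fun b => cond b A B) (v := fun b => cond b v w) (l := l)
      (by rintro (_ | _); exacts [hy.1, hx.1]) (by rintro (_ | _); exacts [hB.1, hA.1])
      (by simp; linarith [hA.2, hB.2]) (by rintro (_ | _) <;> simpa)
    simpa using this
  have h1 : ∀ w ∈ bellmanValues y B l,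
      bellman x A l ≤ 2 * bellman ((x + y) / 2) ((A + B) / 2) l - w := fun w hw =>
    csSup_le (bellmanValues_nonempty hx hA l) fun v hv => by linarith [key v hv w hw]
  have h2 : bellman y B l ≤ 2 * bellman ((x + y) / 2) ((A + B) / 2) l - bellman x A l :=
    csSup_le (bellmanValues_nonempty hy hB l) fun w hw => by linarith [h1 w hw]
  linarith

/-- Glue two copies of one configuration under the root. -/
lemma bellman_jump {x A l : ℝ} (hx : x ∈ Icc (0 : ℝ) 1) (hA : A ∈ Icc (1 : ℝ) 2) :
    bellman x (A - 1) (l - x) ≤ bellman x A l := by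
  refine csSup_le (bellmanValues_nonempty hx ⟨by linarith [hA.1], by linarith [hA.2]⟩ _)
    fun v hv => le_csSup (bddAbove_bellmanValues _ _ _) ?_
  have := glue_mem_bellmanValues (top := True) (x := fun _ => x) (A := fun _ => A - 1)
    (v := fun _ => v) (l := l) (fun _ => hx.1) (fun _ => by linarith [hA.1])
    (by simp; linarith [hA.2]) (by simpa using hv)
  simpa using this

/-- A bounded midpoint concave function on a segment lies above its chord. -/
lemma le_of_midpoint_concave {g : ℝ → ℝ} (h0 : ∀ t ∈ Icc (0 : ℝ) 1, 0 ≤ g t)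
    (hg : ∀ s ∈ Icc (0 : ℝ) 1, ∀ t ∈ Icc (0 : ℝ) 1, (g s + g t) / 2 ≤ g ((s + t) / 2))
    {t : ℝ} (ht : t ∈ Icc (0 : ℝ) 1) : (1 - t) * g 0 + t * g 1 ≤ g t := by
  have z : (0 : ℝ) ∈ Icc (0 : ℝ) 1 := by simp
  have o : (1 : ℝ) ∈ Icc (0 : ℝ) 1 := by simp
  -- A bound for the defect below the chord: for `n = 0` it is just nonnegativity, and pairing `t`
  -- with an endpoint halves it. No continuity is needed.
  have key : ∀ n : ℕ, ∀ t ∈ Icc (0 : ℝ) 1, (1 - t) * g 0 + t * g 1 - (g 0 + g 1) / 2 ^ n ≤ g t := by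
    intro n
    induction n with
    | zero =>
      intro t ht
      have h1 := h0 t ht
      have h2 := mul_nonneg ht.1 (h0 0 z)
      have h3 := mul_nonneg (sub_nonneg.2 ht.2) (h0 1 o)
      simp only [pow_zero, div_one]
      linarith
    | succ n ih =>
      intro t ht
      rcases le_total t (1 / 2) with h | h
      · have m : 2 * t ∈ Icc (0 : ℝ) 1 := ⟨by linarith [ht.1], by linarith⟩
        have h1 := ih (2 * t) m
        have h2 := hg 0 z (2 * t) m
        rw [show (0 + 2 * t) / 2 = t by ring] at h2
        rw [pow_succ, ← div_div]
        linarith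
      · have m : 2 * t - 1 ∈ Icc (0 : ℝ) 1 := ⟨by linarith, by linarith [ht.2]⟩
        have h1 := ih (2 * t - 1) m
        have h2 := hg 1 o (2 * t - 1) m
        rw [show (1 + (2 * t - 1)) / 2 = t by ring] at h2
        rw [pow_succ, ← div_div]
        linarith
  have lim : Filter.Tendsto (fun n : ℕ => (1 - t) * g 0 + t * g 1 - (g 0 + g 1) / 2 ^ n)
      Filter.atTop (nhds ((1 - t) * g 0 + t * g 1 - 0)) := by
    refine tendsto_const_nhds.sub ?_
    have := (tendsto_pow_atTop_nhds_zero_of_lt_one (r := (1 / 2 : ℝ)) (by norm_num)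
      (by norm_num)).const_mul (g 0 + g 1)
    simpa [div_eq_mul_inv] using this
  rw [sub_zero] at lim
  exact le_of_tendsto' lim fun n => key n t ht

/-! ### Upper bound by functions with the two inequalities. -/

/-- Members of a collection of generation less than `n`. -/
def trunc (n : ℕ) (S : Set DyadicInt) : Set DyadicInt := {J ∈ S | J.1 < n}

lemma half_trunc (n : ℕ) (S : Set DyadicInt) (b : Bool) :
    half (trunc (n + 1) S) b = trunc n (half S b) := by
  ext I
  simp [half, trunc, child]

lemma unit_mem_trunc (n : ℕ) (S : Set DyadicInt) :
    DyadicInt.unit ∈ trunc (n + 1) S ↔ DyadicInt.unit ∈ S := by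
  simp [trunc, DyadicInt.unit]

lemma sparseOp_trunc_mono {m n : ℕ} (h : m ≤ n) (S : Set DyadicInt) {E : Set ℝ}
    (hE : NullMeasurableSet E volume) (t : ℝ) :
    sparseOp (trunc m S) (E.indicator fun _ => 1) t ≤ sparseOp (trunc n S) (E.indicator fun _ => 1) t := by
  rw [sparseOp_indicator _ hE, sparseOp_indicator _ hE]
  refine ENNReal.tsum_le_tsum fun J => ?_
  have hmn : trunc m S ⊆ trunc n S := fun J hJ => ⟨hJ.1, hJ.2.trans_le h⟩
  exact indicator_le_indicator_of_subset hmn (fun _ => bot_le) J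

lemma exists_lt_sparseOp_trunc (S : Set DyadicInt) {E : Set ℝ} (hE : NullMeasurableSet E volume)
    {t : ℝ} {a : ℝ≥0∞} (ha : a < sparseOp S (E.indicator fun _ => 1) t) :
    ∃ n, a < sparseOp (trunc n S) (E.indicator fun _ => 1) t := by
  rw [sparseOp_indicator _ hE, ENNReal.tsum_eq_iSup_sum, lt_iSup_iff] at ha
  obtain ⟨s, hs⟩ := ha
  refine ⟨s.sup (fun J => J.1) + 1, hs.trans_le ?_⟩
  rw [sparseOp_indicator _ hE]
  refine le_trans (Finset.sum_le_sum fun J hJ => ?_) (ENNReal.sum_le_tsum s)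
  by_cases h : J ∈ S
  · have h1 : J ∈ trunc (s.sup (fun J => J.1) + 1) S :=
      ⟨h, Nat.lt_succ_of_le (Finset.le_sup (f := fun J : DyadicInt => J.1) hJ)⟩
    rw [indicator_of_mem h, indicator_of_mem h1]
  · rw [indicator_of_notMem h]
    exact bot_le

lemma toReal_carlesonHeight_mem {S : Set DyadicInt} (hS : IsCarleson S) :
    (carlesonHeight (binarySeq S) DyadicInt.unit).toReal ∈ Icc (0 : ℝ) 2 :=
  ⟨ENNReal.toReal_nonneg, ENNReal.toReal_le_of_le_ofReal zero_le_two
    (by simpa using ((isCarleson_iff S).1 hS).1)⟩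

lemma carlesonHeight_ne_top {S : Set DyadicInt} (hS : IsCarleson S) :
    carlesonHeight (binarySeq S) DyadicInt.unit ≠ ∞ :=
  (((isCarleson_iff S).1 hS).1.trans_lt (by simp)).ne

/-- A function that is midpoint concave and satisfies the jump inequality bounds the level sets of
truncated operators. -/
lemma volume_levelSet_trunc_le {U : ℝ → ℝ → ℝ → ℝ}
    (nonneg : ∀ x ∈ Icc (0 : ℝ) 1, ∀ A ∈ Icc (0 : ℝ) 2, ∀ l, 0 ≤ U x A l)
    (nonpos : ∀ x ∈ Icc (0 : ℝ) 1, ∀ A ∈ Icc (0 : ℝ) 2, ∀ l ≤ 0, U x A l = 1)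
    (mid : ∀ x ∈ Icc (0 : ℝ) 1, ∀ y ∈ Icc (0 : ℝ) 1, ∀ A ∈ Icc (0 : ℝ) 2, ∀ B ∈ Icc (0 : ℝ) 2, ∀ l,
      (U x A l + U y B l) / 2 ≤ U ((x + y) / 2) ((A + B) / 2) l)
    (jump : ∀ x ∈ Icc (0 : ℝ) 1, ∀ A ∈ Icc (1 : ℝ) 2, ∀ l, U x (A - 1) (l - x) ≤ U x A l)
    (n : ℕ) : ∀ (S : Set DyadicInt) (E : Set ℝ) (l : ℝ), IsCarleson S → NullMeasurableSet E volume →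
      E ⊆ Ico 0 1 → (volume (levelSet (trunc n S) E l)).toReal ≤
        U (volume E).toReal (carlesonHeight (binarySeq S) DyadicInt.unit).toReal l := by
  classical
  -- Only the operator is truncated: the height on the right is that of the whole `S`, so it obeys
  -- the exact recursion `carlesonHeight_unit`.
  induction n with
  | zero =>
    intro S E l hS hE hE1
    have mx : (volume E).toReal ∈ Icc (0 : ℝ) 1 := ⟨ENNReal.toReal_nonneg, toReal_volume_le_one hE1⟩
    rcases le_or_gt l 0 with hl | hl
    · rw [nonpos _ mx _ (toReal_carlesonHeight_mem hS) l hl]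
      exact toReal_volume_le_one (levelSet_subset _ _ _)
    · have : levelSet (trunc 0 S) E l = ∅ := by
        ext t
        simp [levelSet, sparseOp_indicator _ hE, trunc, hl]
      rw [this]
      simpa using nonneg _ mx _ (toReal_carlesonHeight_mem hS) l
  | succ n ih =>
    intro S E l hS hE hE1
    have hSb := ((isCarleson_iff S).1 hS).2
    set x : Bool → ℝ := fun b => (volume (halfSet E b)).toReal with hxdef
    set A : Bool → ℝ := fun b => (carlesonHeight (binarySeq (half S b)) DyadicInt.unit).toReal
      with hAdef
    have hx : ∀ b, x b ∈ Icc (0 : ℝ) 1 := fun b =>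
      ⟨ENNReal.toReal_nonneg, toReal_volume_le_one (halfSet_subset E b)⟩
    have hA : ∀ b, A b ∈ Icc (0 : ℝ) 2 := fun b => toReal_carlesonHeight_mem (hSb b)
    have hxx : (volume E).toReal = (x true + x false) / 2 := toReal_volume_eq_sum_halves hE1
    have hAA : (carlesonHeight (binarySeq S) DyadicInt.unit).toReal =
        (if DyadicInt.unit ∈ S then 1 else 0) + (A true + A false) / 2 := by
      rw [carlesonHeight_unit, Fintype.sum_bool, ENNReal.toReal_add (by split_ifs <;> simp)
        (ENNReal.div_ne_top (ENNReal.add_ne_top.2 ⟨carlesonHeight_ne_top (hSb _),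
          carlesonHeight_ne_top (hSb _)⟩) (by simp)), ENNReal.toReal_div,
        ENNReal.toReal_add (carlesonHeight_ne_top (hSb _)) (carlesonHeight_ne_top (hSb _))]
      congr 1
      split_ifs <;> simp
    have h : ∀ b, halfSet (levelSet (trunc (n + 1) S) E l) b = levelSet (trunc n (half S b))
        (halfSet E b) (l - if DyadicInt.unit ∈ S then (x true + x false) / 2 else 0) := by
      intro b
      rw [halfSet_levelSet _ hE hE1 ENNReal.toReal_nonneg
        (ENNReal.ofReal_toReal (volume_ne_top_of_subset hE1)).symm, half_trunc, hxx]
      simp only [unit_mem_trunc]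
    rw [toReal_volume_eq_sum_halves (levelSet_subset _ _ _), h, h]
    have h1 := fun b => ih (half S b) (halfSet E b)
      (l - if DyadicInt.unit ∈ S then (x true + x false) / 2 else 0) (hSb b)
      (nullMeasurable_halfSet hE b) (halfSet_subset E b)
    have h2 := mid _ (hx true) _ (hx false) _ (hA true) _ (hA false)
      (l - if DyadicInt.unit ∈ S then (x true + x false) / 2 else 0)
    have h3 : U ((x true + x false) / 2) ((A true + A false) / 2)
        (l - if DyadicInt.unit ∈ S then (x true + x false) / 2 else 0) ≤
        U (volume E).toReal (carlesonHeight (binarySeq S) DyadicInt.unit).toReal l := by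
      have hA2 := (toReal_carlesonHeight_mem hS).2
      rw [hxx, hAA]
      rw [hAA] at hA2
      split_ifs with htop
      · rw [if_pos htop] at hA2
        have := jump ((x true + x false) / 2) ⟨by linarith [(hx true).1, (hx false).1],
          by linarith [(hx true).2, (hx false).2]⟩ (1 + (A true + A false) / 2)
          ⟨by linarith [(hA true).1, (hA false).1], hA2⟩ l
        rwa [add_sub_cancel_left] at this
      · simp
    linarith [h1 true, h1 false]

/-- A point where the full operator is at least `l` is reached by some truncation at any level `l' <
l`, but possibly by none at `l` itself. This is why `left` is required. -/
lemma le_of_mem_bellmanValues {U : ℝ → ℝ → ℝ → ℝ}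
    (nonneg : ∀ x ∈ Icc (0 : ℝ) 1, ∀ A ∈ Icc (0 : ℝ) 2, ∀ l, 0 ≤ U x A l)
    (nonpos : ∀ x ∈ Icc (0 : ℝ) 1, ∀ A ∈ Icc (0 : ℝ) 2, ∀ l ≤ 0, U x A l = 1)
    (mid : ∀ x ∈ Icc (0 : ℝ) 1, ∀ y ∈ Icc (0 : ℝ) 1, ∀ A ∈ Icc (0 : ℝ) 2, ∀ B ∈ Icc (0 : ℝ) 2, ∀ l,
      (U x A l + U y B l) / 2 ≤ U ((x + y) / 2) ((A + B) / 2) l)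
    (jump : ∀ x ∈ Icc (0 : ℝ) 1, ∀ A ∈ Icc (1 : ℝ) 2, ∀ l, U x (A - 1) (l - x) ≤ U x A l)
    (left : ∀ x ∈ Icc (0 : ℝ) 1, ∀ A ∈ Icc (0 : ℝ) 2, ∀ l > 0, ∀ ε > 0,
      ∃ l' < l, U x A l' ≤ U x A l + ε)
    {x A l v : ℝ} (hx : x ∈ Icc (0 : ℝ) 1) (hA : A ∈ Icc (0 : ℝ) 2)
    (hv : v ∈ bellmanValues x A l) : v ≤ U x A l := by
  rcases le_or_gt l 0 with hl | hl
  · rw [nonpos x hx A hA l hl]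
    exact bellmanValues_le_one hv
  obtain ⟨E, S, hE, hE1, hEx, hS, hSA, rfl⟩ := hv
  refine le_of_forall_pos_le_add fun ε hε => ?_
  obtain ⟨l', hl', hU⟩ := left x hx A hA l hl ε hε
  refine le_trans ?_ hU
  have hsub : levelSet S E l ⊆ ⋃ n, levelSet (trunc n S) E l' := by
    rintro t ⟨ht, hlt⟩
    obtain ⟨n, hn⟩ := exists_lt_sparseOp_trunc S hE
      (((ENNReal.ofReal_lt_ofReal_iff hl).2 hl').trans_le hlt)
    exact mem_iUnion.2 ⟨n, ht, hn.le⟩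
  have hmono : Monotone fun n => levelSet (trunc n S) E l' := fun m n h t ht =>
    ⟨ht.1, ht.2.trans (sparseOp_trunc_mono h S hE t)⟩
  have hbound : volume (levelSet S E l) ≤ ENNReal.ofReal (U x A l') := by
    refine (measure_mono hsub).trans ?_
    rw [hmono.measure_iUnion]
    refine iSup_le fun n => ?_
    rw [← ENNReal.ofReal_toReal (volume_ne_top_of_subset (levelSet_subset (trunc n S) E l'))]
    refine ENNReal.ofReal_le_ofReal ?_
    have := volume_levelSet_trunc_le nonneg nonpos mid jump n S E l' hS hE hE1
    rwa [hEx, hSA, ENNReal.toReal_ofReal hx.1, ENNReal.toReal_ofReal hA.1] at this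
  exact ENNReal.toReal_le_of_le_ofReal (nonneg x hx A hA l') hbound

/-! ### The concave profile and the curves derived from it. -/

/-- The lines whose lower envelope is `profile`. -/
def profileLine : ℕ → ℝ → ℝ
  | 0, y => 3 * y
  | j + 1, y => 2 + j + y / 2 ^ j

/-- The piecewise linear concave function through `(0,0)` and the points `(2 ^ j, j + 3)`. -/
def profile (y : ℝ) : ℝ := ⨅ j, profileLine j y

lemma profileLine_nonneg (j : ℕ) {y : ℝ} (hy : 0 ≤ y) : 0 ≤ profileLine j y := by
  cases j <;> simp only [profileLine] <;> positivity

lemma bddBelow_profileLine {y : ℝ} (hy : 0 ≤ y) : BddBelow (range fun j => profileLine j y) :=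
  ⟨0, by rintro _ ⟨j, rfl⟩; exact profileLine_nonneg j hy⟩

lemma profile_le (j : ℕ) {y : ℝ} (hy : 0 ≤ y) : profile y ≤ profileLine j y :=
  ciInf_le (bddBelow_profileLine hy) j

lemma profileLine_combo (j : ℕ) {a b : ℝ} (x y : ℝ) (h : a + b = 1) :
    profileLine j (a * x + b * y) = a * profileLine j x + b * profileLine j y := by
  obtain rfl : b = 1 - a := by linarith
  cases j <;> simp only [profileLine] <;> ring

lemma profile_concave : ConcaveOn ℝ (Ici 0) profile := by
  refine ⟨convex_Ici 0, fun x hx y hy a b ha hb hab => le_ciInf fun j => ?_⟩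
  simp only [smul_eq_mul]
  rw [profileLine_combo j x y hab]
  have h1 := mul_le_mul_of_nonneg_left (profile_le j hx) ha
  have h2 := mul_le_mul_of_nonneg_left (profile_le j hy) hb
  linarith

lemma profile_mono {x y : ℝ} (hx : 0 ≤ x) (hxy : x ≤ y) : profile x ≤ profile y := by
  refine le_ciInf fun j => (profile_le j hx).trans ?_
  cases j <;> simp only [profileLine] <;> gcongr

lemma profile_sub_le {x y : ℝ} (hx : 0 ≤ x) (hxy : x ≤ y) : profile y - profile x ≤ 3 * (y - x) := by
  have : profile y - 3 * (y - x) ≤ profile x := by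
    refine le_ciInf fun j => ?_
    have h1 := profile_le j (hx.trans hxy)
    have h2 : profileLine j y ≤ profileLine j x + 3 * (y - x) := by
      cases j with
      | zero => simp only [profileLine]; linarith
      | succ j =>
        simp only [profileLine]
        have h3 : (y - x) / 2 ^ j ≤ y - x :=
          div_le_self (by linarith) (one_le_pow₀ one_le_two)
        rw [sub_div] at h3
        linarith
    linarith
  linarith

lemma add_one_le_two_pow (d : ℕ) : (d : ℝ) + 1 ≤ 2 ^ d := by
  have := one_add_mul_le_pow (a := (1 : ℝ)) (by norm_num) d
  norm_num at this
  linarith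

lemma profile_of_le_one {y : ℝ} (h0 : 0 ≤ y) (h1 : y ≤ 1) : profile y = 3 * y := by
  refine le_antisymm (profile_le 0 h0) (le_ciInf fun j => ?_)
  cases j with
  | zero => simp [profileLine]
  | succ j =>
    simp only [profileLine]
    cases j with
    | zero => simp; linarith
    | succ j =>
      have : 0 ≤ y / 2 ^ (j + 1) := by positivity
      push_cast
      have := j.cast_nonneg (α := ℝ)
      linarith

lemma profile_of_mem {j : ℕ} {y : ℝ} (h0 : 2 ^ j ≤ y) (h1 : y ≤ 2 ^ (j + 1)) :
    profile y = 2 + j + y / 2 ^ j := by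
  have hp : (0 : ℝ) < 2 ^ j := by positivity
  have hy : 0 ≤ y := hp.le.trans h0
  refine le_antisymm (profile_le (j + 1) hy) (le_ciInf fun i => ?_)
  -- After rescaling to `z ∈ [1,2]`, comparison with a line `d` steps later is `z - d ≤ z / 2 ^ d`,
  -- and with one `d` steps earlier it follows from `d + 1 ≤ 2 ^ d`.
  obtain ⟨z, hz⟩ : ∃ z, y = 2 ^ j * z := ⟨y / 2 ^ j, by field_simp⟩
  have z1 : 1 ≤ z := by
    rw [hz] at h0
    exact (le_mul_iff_one_le_right hp).1 h0
  have z2 : z ≤ 2 := by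
    rw [hz, pow_succ] at h1
    exact le_of_mul_le_mul_left h1 hp
  have e : y / 2 ^ j = z := by rw [hz]; field_simp
  rw [e]
  cases i with
  | zero =>
    simp only [profileLine]
    have := add_one_le_two_pow j
    rw [hz]
    nlinarith
  | succ i =>
    simp only [profileLine]
    rcases le_total j i with h | h
    · obtain ⟨d, rfl⟩ := Nat.exists_eq_add_of_le h
      have e2 : y / 2 ^ (j + d) = z / 2 ^ d := by
        rw [hz, pow_add]
        field_simp
      have h3 := add_one_le_two_pow d
      have h4 : (0 : ℝ) < 2 ^ d := by positivity
      have h5 : z - d ≤ z / 2 ^ d := by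
        rw [le_div_iff₀ h4]
        rcases Nat.lt_or_ge d 2 with hd | hd
        · (interval_cases d <;> norm_num); linarith
        · have : (2 : ℝ) ≤ d := by exact_mod_cast hd
          nlinarith
      push_cast
      rw [e2]
      linarith
    · obtain ⟨d, rfl⟩ := Nat.exists_eq_add_of_le h
      have e2 : y / 2 ^ i = z * 2 ^ d := by
        rw [hz, pow_add]
        field_simp
      have h3 := add_one_le_two_pow d
      push_cast
      rw [e2]
      nlinarith

lemma exists_pow_le_le {y : ℝ} (h : 1 ≤ y) : ∃ j : ℕ, (2 : ℝ) ^ j ≤ y ∧ y ≤ 2 ^ (j + 1) := by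
  obtain ⟨j, h1, h2⟩ := exists_nat_pow_near h one_lt_two
  exact ⟨j, h1, h2.le⟩

lemma profile_two_mul {y : ℝ} (h : 1 ≤ y) : profile (2 * y) = profile y + 1 := by
  obtain ⟨j, h1, h2⟩ := exists_pow_le_le h
  rw [profile_of_mem h1 h2, profile_of_mem (j := j + 1) (by rw [pow_succ]; linarith)
    (by rw [pow_succ _ (j + 1)]; linarith), pow_succ]
  push_cast
  field_simp
  ring

lemma profile_two_pow (j : ℕ) : profile (2 ^ j) = j + 3 := by
  rw [profile_of_mem le_rfl (pow_le_pow_right₀ one_le_two j.le_succ), div_self (by positivity)]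
  ring

/-- The function with graph `Gam m`. -/
def curve (m : ℕ) (x : ℝ) : ℝ := profile (2 ^ m * x) - x

lemma curve_zero {x : ℝ} (hx : x ∈ Icc (0 : ℝ) 1) : curve 0 x = 2 * x := by
  simp only [curve, pow_zero, one_mul]
  rw [profile_of_le_one hx.1 hx.2]
  ring

/-- The geometric form of one jump: the root lowers the level by `x`, and concentration on one half
doubles the density. -/
lemma curve_succ (m : ℕ) (x : ℝ) : curve (m + 1) x = curve m (2 * x) + x := by
  simp only [curve, pow_succ]
  ring_nf

lemma curve_succ_of_ge (m : ℕ) {x : ℝ} (h0 : 1 / 2 ≤ x) (h1 : x ≤ 1) :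
    curve (m + 1) x = m + 2 + x := by
  have hp : (0 : ℝ) < 2 ^ m := by positivity
  rw [curve, profile_of_mem (j := m) (by rw [pow_succ]; nlinarith) (by rw [pow_succ]; nlinarith),
    pow_succ]
  field_simp
  ring

lemma curve_at_zero (m : ℕ) : curve m 0 = 0 := by
  simp [curve, profile_of_le_one]

lemma curve_at_one (m : ℕ) : curve m 1 = m + 2 := by
  rw [curve, mul_one, profile_two_pow]
  ring

/-- By `curve_succ` on `[0, 1/2]`; on `[1/2, 1]` the slope is exactly `1`. It makes the curves
strictly increasing and their inverses `1`-Lipschitz. -/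
lemma sub_le_curve_sub (m : ℕ) : ∀ {x y : ℝ}, 0 ≤ x → x ≤ y → y ≤ 1 →
    y - x ≤ curve m y - curve m x := by
  induction m with
  | zero =>
    intro x y h0 h1 h2
    rw [curve_zero ⟨h0, h1.trans h2⟩, curve_zero ⟨h0.trans h1, h2⟩]
    linarith
  | succ m ih =>
    have low : ∀ {x y : ℝ}, 0 ≤ x → x ≤ y → y ≤ 1 / 2 →
        y - x ≤ curve (m + 1) y - curve (m + 1) x := by
      intro x y h0 h1 h2
      rw [curve_succ, curve_succ]
      have := ih (x := 2 * x) (y := 2 * y) (by linarith) (by linarith) (by linarith)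
      linarith
    have high : ∀ {x y : ℝ}, 1 / 2 ≤ x → x ≤ y → y ≤ 1 →
        y - x ≤ curve (m + 1) y - curve (m + 1) x := by
      intro x y h0 h1 h2
      rw [curve_succ_of_ge m h0 (h1.trans h2), curve_succ_of_ge m (h0.trans h1) h2]
      linarith
    intro x y h0 h1 h2
    rcases le_total y (1 / 2) with h | h
    · exact low h0 h1 h
    rcases le_total (1 / 2) x with h' | h'
    · exact high h' h1 h2
    · have e1 := low h0 h' le_rfl
      have e2 := high le_rfl h h2
      linarith

lemma curve_strictMonoOn (m : ℕ) : StrictMonoOn (curve m) (Icc 0 1) := by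
  intro x hx y hy h
  have := sub_le_curve_sub m hx.1 h.le hy.2
  linarith

lemma curve_continuousOn (m : ℕ) : ContinuousOn (curve m) (Icc 0 1) := by
  have h : LipschitzOnWith 3 profile (Ici 0) := by
    refine LipschitzOnWith.of_dist_le_mul fun x hx y hy => ?_
    rw [Real.dist_eq, Real.dist_eq]
    rcases le_total x y with hxy | hxy
    · have h1 := profile_mono hx hxy
      have h2 := profile_sub_le hx hxy
      rw [abs_of_nonpos (by linarith), abs_of_nonpos (by linarith)]
      simp
      linarith
    · have h1 := profile_mono hy hxy
      have h2 := profile_sub_le hy hxy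
      rw [abs_of_nonneg (by linarith), abs_of_nonneg (by linarith)]
      simp
      linarith
  refine ContinuousOn.sub (h.continuousOn.comp (by fun_prop) fun x hx => ?_) continuousOn_id
  exact mul_nonneg (by positivity) hx.1

lemma curve_le_succ (m : ℕ) {x : ℝ} (hx : 0 ≤ x) : curve m x ≤ curve (m + 1) x := by
  have := profile_mono (x := 2 ^ m * x) (y := 2 ^ (m + 1) * x) (by positivity)
    (by rw [pow_succ]; nlinarith [mul_nonneg (show (0 : ℝ) ≤ 2 ^ m by positivity) hx])
  simp only [curve]
  linarith

lemma curve_mono_index {m n : ℕ} (h : m ≤ n) {x : ℝ} (hx : 0 ≤ x) : curve m x ≤ curve n x :=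
  monotone_nat_of_le_succ (fun m => curve_le_succ m hx) h

lemma exists_le_curve {x : ℝ} (h0 : 0 < x) (h1 : x ≤ 1) (l : ℝ) : ∃ m, l ≤ curve m x := by
  obtain ⟨k, hk⟩ := exists_pow_lt_of_lt_one h0 (show (1 / 2 : ℝ) < 1 by norm_num)
  obtain ⟨n, hn⟩ := exists_nat_ge l
  refine ⟨n + k, hn.trans ?_⟩
  have h2 : (2 : ℝ) ^ n ≤ 2 ^ (n + k) * x := by
    rw [pow_add, mul_assoc]
    refine le_mul_of_one_le_right (by positivity) ?_
    rw [one_div, inv_pow, inv_lt_iff_one_lt_mul₀' (by positivity)] at hk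
    exact hk.le
  have h3 := profile_mono (by positivity) h2
  rw [profile_two_pow] at h3
  rw [curve]
  linarith

/-! ### The curves as graphs, and their inverse functions. -/

lemma mem_segment_iff {a b u v x l : ℝ} (hab : a < b) :
    (x, l) ∈ segment ℝ (a, u) (b, v) ↔ x ∈ Icc a b ∧ l = u + (v - u) / (b - a) * (x - a) := by
  have hab' : b - a ≠ 0 := by linarith
  rw [segment_eq_image]
  simp only [mem_image, Prod.smul_mk, Prod.mk_add_mk, Prod.mk.injEq, smul_eq_mul]
  constructor
  · rintro ⟨t, ⟨h0, h1⟩, rfl, rfl⟩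
    refine ⟨⟨by nlinarith, by nlinarith⟩, ?_⟩
    field_simp
    ring
  · rintro ⟨⟨h0, h1⟩, rfl⟩
    refine ⟨(x - a) / (b - a), ⟨div_nonneg (by linarith) (by linarith), ?_⟩, ?_, ?_⟩
    · rw [div_le_one (by linarith)]
      linarith
    · field_simp
      ring
    · field_simp
      ring

lemma mem_segment_last_iff (m : ℕ) {x l : ℝ} :
    (x, l) ∈ segment ℝ (0, 0) (F m m) ↔ x ∈ Icc 0 (1 / 2 ^ m : ℝ) ∧ l = curve m x := by
  rw [F, mem_segment_iff (by positivity)]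
  refine and_congr_right fun hx => ?_
  have hp : (0 : ℝ) < 2 ^ m := by positivity
  have h1 : 2 ^ m * x ≤ 1 := by
    have := hx.2
    rwa [le_div_iff₀ hp, mul_comm] at this
  rw [curve, profile_of_le_one (mul_nonneg hp.le hx.1) h1]
  have : (0 : ℝ) + ((m : ℝ) - m + 3 - 1 / 2 ^ m - 0) / (1 / 2 ^ m - 0) * (x - 0) =
      3 * (2 ^ m * x) - x := by
    field_simp
    ring
  rw [this]

lemma mem_segment_F_iff {m k : ℕ} (hk : k < m) {x l : ℝ} :
    (x, l) ∈ segment ℝ (F m (k + 1)) (F m k) ↔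
      x ∈ Icc (1 / 2 ^ (k + 1) : ℝ) (1 / 2 ^ k) ∧ l = curve m x := by
  rw [F, F, mem_segment_iff (by gcongr <;> norm_num)]
  refine and_congr_right fun hx => ?_
  obtain ⟨j, rfl⟩ : ∃ j, m = j + k + 1 := ⟨m - k - 1, by omega⟩
  have hp : (0 : ℝ) < 2 ^ k := by positivity
  have hq : (0 : ℝ) < 2 ^ j := by positivity
  obtain ⟨h0, h1⟩ := hx
  rw [div_le_iff₀ (by positivity)] at h0
  rw [le_div_iff₀ hp] at h1
  rw [pow_succ] at h0
  rw [curve, profile_of_mem (j := j)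
    (by rw [pow_succ, pow_add]; nlinarith) (by rw [pow_succ, pow_add, pow_succ]; nlinarith)]
  have : ((j + k + 1 : ℕ) : ℝ) - ((k + 1 : ℕ) : ℝ) + 3 - 1 / 2 ^ (k + 1) +
      (((j + k + 1 : ℕ) : ℝ) - k + 3 - 1 / 2 ^ k -
        (((j + k + 1 : ℕ) : ℝ) - ((k + 1 : ℕ) : ℝ) + 3 - 1 / 2 ^ (k + 1))) /
      (1 / 2 ^ k - 1 / 2 ^ (k + 1)) * (x - 1 / 2 ^ (k + 1)) =
      2 + j + 2 ^ (j + k + 1) * x / 2 ^ j - x := by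
    push_cast
    have e : (1 / 2 ^ k - 1 / 2 ^ (k + 1) : ℝ) = 1 / 2 ^ (k + 1) := by
      rw [pow_succ]
      field_simp
      norm_num
    rw [e, pow_add, pow_add, pow_succ]
    field_simp
    ring
  rw [this]

/-- Both suprema defining `gam` and `alp` are therefore over singletons in the relevant range, and
`Gam` is not needed further. -/
lemma mem_Gam_iff {m : ℕ} {x l : ℝ} : (x, l) ∈ Gam m ↔ x ∈ Icc (0 : ℝ) 1 ∧ l = curve m x := by
  simp only [Gam, mem_union, mem_iUnion, Finset.mem_range, mem_segment_last_iff, exists_prop]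
  constructor
  · rintro (⟨hx, h⟩ | ⟨k, hk, h⟩)
    · exact ⟨⟨hx.1, hx.2.trans (div_le_one_of_le₀ (one_le_pow₀ one_le_two) (by positivity))⟩, h⟩
    · obtain ⟨hx, h⟩ := (mem_segment_F_iff hk).1 h
      exact ⟨⟨le_trans (by positivity) hx.1,
        hx.2.trans (div_le_one_of_le₀ (one_le_pow₀ one_le_two) (by positivity))⟩, h⟩
  · rintro ⟨⟨h0, h1⟩, h⟩
    rcases le_or_gt x (1 / 2 ^ m) with hm | hm
    · exact Or.inl ⟨⟨h0, hm⟩, h⟩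
    · right
      have hp : (0 : ℝ) < 2 ^ m := by positivity
      have hx : 0 < x := lt_trans (by positivity) hm
      obtain ⟨k, hk1, hk2⟩ := exists_pow_le_le (one_le_one_div hx h1)
      have hk3 : x ≤ 1 / 2 ^ k := by
        rw [le_div_iff₀ (by positivity)]
        rw [le_div_iff₀ hx] at hk1
        linarith
      have hk4 : 1 / 2 ^ (k + 1) ≤ x := by
        rw [div_le_iff₀ (by positivity)]
        rw [div_le_iff₀ hx] at hk2
        linarith
      have hkm : k < m := by
        have := hm.trans_le hk3
        rw [one_div_lt_one_div hp (by positivity)] at this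
        exact (pow_lt_pow_iff_right₀ one_lt_two).1 this
      exact ⟨k, hkm, (mem_segment_F_iff hkm).2 ⟨⟨hk4, hk3⟩, h⟩⟩

lemma gam_eq (m : ℕ) {x : ℝ} (hx : x ∈ Icc (0 : ℝ) 1) : gam m x = curve m x := by
  have : {l | (x, l) ∈ Gam m} = {curve m x} := by
    ext l
    simp [mem_Gam_iff, hx.1, hx.2]
  rw [gam, this, csSup_singleton]

lemma alp_curve (m : ℕ) {x : ℝ} (hx : x ∈ Icc (0 : ℝ) 1) : alp m (curve m x) = x := by
  have : {y | (y, curve m x) ∈ Gam m} = {x} := by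
    ext y
    simp only [mem_Gam_iff, mem_ofPred_eq, mem_singleton_iff]
    constructor
    · rintro ⟨h1, h2⟩
      exact ((curve_strictMonoOn m).injOn hx h1 h2).symm
    · rintro rfl
      exact ⟨hx, rfl⟩
  rw [alp, this, csSup_singleton]

lemma exists_curve_eq (m : ℕ) {l : ℝ} (h0 : 0 ≤ l) (h1 : l ≤ m + 2) :
    ∃ x ∈ Icc (0 : ℝ) 1, curve m x = l := by
  have := intermediate_value_Icc zero_le_one (curve_continuousOn m)
  rw [curve_at_zero, curve_at_one] at this
  exact this ⟨h0, h1⟩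

lemma alp_mem (m : ℕ) {l : ℝ} (h0 : 0 ≤ l) (h1 : l ≤ m + 2) : alp m l ∈ Icc (0 : ℝ) 1 := by
  obtain ⟨x, hx, rfl⟩ := exists_curve_eq m h0 h1
  rwa [alp_curve m hx]

lemma curve_alp (m : ℕ) {l : ℝ} (h0 : 0 ≤ l) (h1 : l ≤ m + 2) : curve m (alp m l) = l := by
  obtain ⟨x, hx, rfl⟩ := exists_curve_eq m h0 h1
  rw [alp_curve m hx]

lemma alp_le_iff (m : ℕ) {x l : ℝ} (h0 : 0 ≤ l) (h1 : l ≤ m + 2) (hx : x ∈ Icc (0 : ℝ) 1) :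
    alp m l ≤ x ↔ l ≤ curve m x := by
  rw [← (curve_strictMonoOn m).le_iff_le (alp_mem m h0 h1) hx, curve_alp m h0 h1]

lemma lt_alp_iff (m : ℕ) {x l : ℝ} (h0 : 0 ≤ l) (h1 : l ≤ m + 2) (hx : x ∈ Icc (0 : ℝ) 1) :
    x < alp m l ↔ curve m x < l := by
  rw [← not_le, alp_le_iff m h0 h1 hx, not_le]

lemma alp_mono (m : ℕ) {l l' : ℝ} (h0 : 0 ≤ l) (h : l ≤ l') (h1 : l' ≤ m + 2) :
    alp m l ≤ alp m l' := by
  rw [alp_le_iff m h0 (h.trans h1) (alp_mem m (h0.trans h) h1), curve_alp m (h0.trans h) h1]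
  exact h

lemma alp_sub_le (m : ℕ) {l l' : ℝ} (h0 : 0 ≤ l) (h : l ≤ l') (h1 : l' ≤ m + 2) :
    alp m l' - alp m l ≤ l' - l := by
  have := sub_le_curve_sub m (alp_mem m h0 (h.trans h1)).1 (alp_mono m h0 h h1)
    (alp_mem m (h0.trans h) h1).2
  rwa [curve_alp m h0 (h.trans h1), curve_alp m (h0.trans h) h1] at this

lemma alp_pos (m : ℕ) {l : ℝ} (h0 : 0 < l) (h1 : l ≤ m + 2) : 0 < alp m l := by
  rw [lt_alp_iff m h0.le h1 (by simp), curve_at_zero]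
  exact h0

/-- At half the abscissa, curve `m + 1` is already at height at least `l`, by `curve_succ`. -/
lemma two_mul_alp_succ_le (m : ℕ) {l : ℝ} (h0 : 0 ≤ l) (h1 : l ≤ m + 2) :
    2 * alp (m + 1) l ≤ alp m l := by
  have h2 := alp_mem m h0 h1
  have : alp (m + 1) l ≤ alp m l / 2 := by
    rw [alp_le_iff _ h0 (by push_cast; linarith) ⟨by linarith [h2.1], by linarith [h2.1, h2.2]⟩,
      curve_succ, mul_div_cancel₀ _ two_ne_zero, curve_alp m h0 h1]
    linarith [h2.1]
  linarith

/-- The abscissas of the points on consecutive curves at one height. -/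
lemma three_mul_alp_le (m : ℕ) {l : ℝ} (h0 : 0 ≤ l) (h1 : l ≤ m + 2) :
    3 * alp (m + 1) l ≤ alp m l + 2 * alp (m + 2) l := by
  have h2 := alp_mem m h0 h1
  have h3 := alp_mem (m + 2) h0 (l := l) (by push_cast; linarith)
  have c2 := curve_alp m h0 h1
  have c3 := curve_alp (m + 2) h0 (l := l) (by push_cast; linarith)
  have h4 := two_mul_alp_succ_le m h0 h1
  have h5 := two_mul_alp_succ_le (m + 1) h0 (l := l) (by push_cast; linarith)
  have h6 := alp_mem (m + 1) h0 (l := l) (by push_cast; linarith)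
  have : alp (m + 1) l ≤ (alp m l + 2 * alp (m + 2) l) / 3 := by
    rw [alp_le_iff _ h0 (by push_cast; linarith)
      ⟨by linarith [h2.1, h3.1], by linarith [h2.2, h6.2, h5]⟩]
    set a := alp (m + 2) l
    set c := alp m l
    simp only [curve] at *
    have hp : (0 : ℝ) < 2 ^ m := by positivity
    -- The weights `2/3, 1/3` absorb the dyadic factors: `2/3 * 2 ^ m * c + 1/3 * 2 ^ (m + 2) * a`
    -- is `2 ^ (m + 1)` times `(c + 2 * a) / 3`.
    have := profile_concave.2 (show 2 ^ m * c ∈ Ici (0 : ℝ) from mul_nonneg hp.le h2.1)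
      (show 2 ^ (m + 2) * a ∈ Ici (0 : ℝ) from mul_nonneg (by positivity) h3.1)
      (show (0 : ℝ) ≤ 2 / 3 by norm_num) (show (0 : ℝ) ≤ 1 / 3 by norm_num) (by norm_num)
    simp only [smul_eq_mul] at this
    rw [show 2 ^ (m + 1) * ((c + 2 * a) / 3) = 2 / 3 * (2 ^ m * c) + 1 / 3 * (2 ^ (m + 2) * a) by
      ring]
    linarith [h3.1]
  linarith

/-! ### Concavity and monotonicity of the function `f`. -/

lemma strip_eq {m : ℕ} {x l : ℝ} (hx : x ∈ Icc (0 : ℝ) 1) (h1 : l ≤ curve m x)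
    (h2 : ∀ n < m, curve n x < l) : strip x l = m := by
  refine le_antisymm (Nat.sInf_le (by simpa [gam_eq m hx] using h1)) ?_
  refine le_csInf ⟨m, by simpa [gam_eq m hx] using h1⟩ fun n hn => ?_
  by_contra! h
  have h3 := h2 n h
  simp only [mem_ofPred_eq, gam_eq n hx] at hn
  linarith

/-- `M` is the index of the lowest curve that meets the horizontal line at height `l > 0`. -/
def IsTop (M : ℕ) (l : ℝ) : Prop := 0 < l ∧ l ≤ M + 2 ∧ (M = 0 ∨ (M : ℝ) + 1 < l)

lemma exists_isTop {l : ℝ} (hl : 0 < l) : ∃ M, IsTop M l := by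
  classical
  have h : ∃ M : ℕ, l ≤ M + 2 := by
    obtain ⟨n, hn⟩ := exists_nat_ge l
    exact ⟨n, by linarith⟩
  refine ⟨Nat.find h, hl, Nat.find_spec h, ?_⟩
  by_cases h0 : Nat.find h = 0
  · exact Or.inl h0
  · right
    have h1 := Nat.find_min h (Nat.sub_lt (Nat.pos_of_ne_zero h0) one_pos)
    rw [Nat.cast_pred (Nat.pos_of_ne_zero h0)] at h1
    linarith

lemma IsTop.le_of_le {M m : ℕ} {l : ℝ} (h : IsTop M l) (hm : M ≤ m) : l ≤ m + 2 := by
  have : (M : ℝ) ≤ m := by exact_mod_cast hm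
  linarith [h.2.1]

lemma IsTop.curve_lt {M n : ℕ} {x l : ℝ} (h : IsTop M l) (hx : x ∈ Icc (0 : ℝ) 1) (hn : n < M) :
    curve n x < l := by
  have h1 := (curve_strictMonoOn n).monotoneOn hx (by simp : (1 : ℝ) ∈ Icc (0 : ℝ) 1) hx.2
  rw [curve_at_one] at h1
  have h2 : (n : ℝ) + 1 ≤ M := by exact_mod_cast hn
  rcases h.2.2 with h3 | h3
  · omega
  · linarith

/-- The slope in `x` of the function `𝐟` between two consecutive curves. -/
def slope (m : ℕ) (l : ℝ) : ℝ := (1 / 2 ^ (m + 1)) / (alp m l - alp (m + 1) l)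

/-- The linear interpolation of `𝐟` between two consecutive curves. -/
def chord (m : ℕ) (l x : ℝ) : ℝ := 1 / 2 ^ m + slope m l * (x - alp m l)

lemma alp_succ_lt (m : ℕ) {l : ℝ} (h0 : 0 < l) (h1 : l ≤ m + 2) : alp (m + 1) l < alp m l := by
  have h2 := two_mul_alp_succ_le m h0.le h1
  have h3 := alp_pos m h0 h1
  linarith

lemma slope_pos (m : ℕ) {l : ℝ} (h0 : 0 < l) (h1 : l ≤ m + 2) : 0 < slope m l := by
  have := alp_succ_lt m h0 h1
  exact div_pos (by positivity) (by linarith)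

lemma slope_mul (m : ℕ) {l : ℝ} (h0 : 0 < l) (h1 : l ≤ m + 2) :
    slope m l * (alp m l - alp (m + 1) l) = 1 / 2 ^ (m + 1) := by
  have := alp_succ_lt m h0 h1
  exact div_mul_cancel₀ _ (by linarith)

lemma chord_eq (m : ℕ) {l : ℝ} (h0 : 0 < l) (h1 : l ≤ m + 2) (x : ℝ) :
    chord m l x = 1 / 2 ^ (m + 1) + slope m l * (x - alp (m + 1) l) := by
  have h2 := slope_mul m h0 h1
  have h3 : (1 / 2 ^ m : ℝ) = 2 * (1 / 2 ^ (m + 1)) := by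
    rw [pow_succ]
    field_simp
  rw [chord, h3]
  linarith

/-- From one strip to the next the increment of `f` halves, while the horizontal gap shrinks at
least by half: this is `three_mul_alp_le`. It is the concavity of `f` in `x`. -/
lemma slope_le_succ (m : ℕ) {l : ℝ} (h0 : 0 < l) (h1 : l ≤ m + 2) : slope m l ≤ slope (m + 1) l := by
  have h2 := alp_succ_lt m h0 h1
  have h3 := alp_succ_lt (m + 1) h0 (l := l) (by push_cast; linarith)
  have h4 := three_mul_alp_le m h0.le h1
  rw [slope, slope, div_le_div_iff₀ (by linarith) (by linarith), pow_succ _ (m + 1)]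
  have hp : (0 : ℝ) < 1 / 2 ^ (m + 1) := by positivity
  have : (1 / (2 ^ (m + 1) * 2) : ℝ) = 1 / 2 ^ (m + 1) / 2 := by field_simp
  rw [this]
  nlinarith

lemma slope_mono {m n : ℕ} (hmn : m ≤ n) {l : ℝ} (h0 : 0 < l) (h1 : l ≤ m + 2) :
    slope m l ≤ slope n l := by
  induction n, hmn using Nat.le_induction with
  | base => exact le_rfl
  | succ n hmn ih =>
    have : (m : ℝ) ≤ n := by exact_mod_cast hmn
    exact ih.trans (slope_le_succ n h0 (by linarith))

lemma chord_succ_le (m : ℕ) {x l : ℝ} (h0 : 0 < l) (h1 : l ≤ m + 2) (hx : x ≤ alp (m + 1) l) :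
    chord (m + 1) l x ≤ chord m l x := by
  rw [chord_eq m h0 h1, chord]
  nlinarith [slope_le_succ m h0 h1]

lemma le_chord_succ (m : ℕ) {x l : ℝ} (h0 : 0 < l) (h1 : l ≤ m + 2) (hx : alp (m + 1) l ≤ x) :
    chord m l x ≤ chord (m + 1) l x := by
  rw [chord_eq m h0 h1, chord]
  nlinarith [slope_le_succ m h0 h1]

lemma alp_anti {m n : ℕ} (hmn : m ≤ n) {l : ℝ} (h0 : 0 < l) (h1 : l ≤ m + 2) :
    alp n l ≤ alp m l := by
  induction n, hmn using Nat.le_induction with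
  | base => exact le_rfl
  | succ n hmn ih =>
    have : (m : ℝ) ≤ n := by exact_mod_cast hmn
    exact (alp_succ_lt n h0 (by linarith)).le.trans ih

lemma chord_le_of_le_alp {m n : ℕ} (hmn : m ≤ n) {x l : ℝ} (h0 : 0 < l) (h1 : l ≤ m + 2)
    (hx : x ≤ alp n l) : chord n l x ≤ chord m l x := by
  induction n, hmn using Nat.le_induction with
  | base => exact le_rfl
  | succ n hmn ih =>
    have : (m : ℝ) ≤ n := by exact_mod_cast hmn
    exact (chord_succ_le n h0 (by linarith) hx).trans
      (ih (hx.trans (alp_succ_lt n h0 (by linarith)).le))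

lemma chord_le_of_alp_le {m n : ℕ} (hmn : m ≤ n) {x l : ℝ} (h0 : 0 < l) (h1 : l ≤ m + 2)
    (hx : alp (m + 1) l ≤ x) : chord m l x ≤ chord n l x := by
  induction n, hmn using Nat.le_induction with
  | base => exact le_rfl
  | succ n hmn ih =>
    have h2 : (m : ℝ) ≤ n := by exact_mod_cast hmn
    refine ih.trans (le_chord_succ n h0 (by linarith) (le_trans ?_ hx))
    exact alp_anti (by omega) h0 (by push_cast; linarith)

lemma f_of_top {M : ℕ} {x l : ℝ} (hM : IsTop M l) (hx : x ∈ Ioc (0 : ℝ) 1) (h : l ≤ curve M x) :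
    f x l = 1 / 2 ^ M := by
  have hs : strip x l = M :=
    strip_eq (Ioc_subset_Icc_self hx) h fun n hn => hM.curve_lt (Ioc_subset_Icc_self hx) hn
  rw [f, if_neg hx.1.ne', hs]
  rcases hM.2.2 with rfl | h3
  · simp
  · split_ifs with h4
    · simp [h4]
    · rfl

lemma f_of_between {m : ℕ} {x l : ℝ} (hx : x ∈ Ioc (0 : ℝ) 1) (h1 : curve m x < l)
    (h2 : l ≤ curve (m + 1) x) (h3 : l ≤ m + 2) : f x l = chord m l x := by
  have hs : strip x l = m + 1 := strip_eq (Ioc_subset_Icc_self hx) h2 fun n hn =>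
    (curve_mono_index (by omega) hx.1.le).trans_lt h1
  have h0 : 0 < l := by
    have := (curve_strictMonoOn m).monotoneOn (by simp) (Ioc_subset_Icc_self hx) hx.1.le
    rw [curve_at_zero] at this
    linarith
  rw [f, if_neg hx.1.ne', hs, if_neg (by omega), if_neg (by push_cast; linarith),
    Nat.add_sub_cancel, chord_eq m h0 h3, lerp]
  congr 2
  rw [slope]
  congr 1
  rw [pow_succ]
  field_simp
  norm_num

/-- Normal form for `f`: constant to the right of the lowest curve meeting the horizontal line, a
chord elsewhere. Later arguments use this in place of `strip`. -/
lemma f_cases {M : ℕ} {x l : ℝ} (hM : IsTop M l) (hx : x ∈ Ioc (0 : ℝ) 1) :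
    (l ≤ curve M x ∧ f x l = 1 / 2 ^ M) ∨
      ∃ m, M ≤ m ∧ curve m x < l ∧ l ≤ curve (m + 1) x ∧ f x l = chord m l x := by
  classical
  have h := exists_le_curve hx.1 hx.2 l
  rcases le_or_gt l (curve M x) with h1 | h1
  · exact Or.inl ⟨h1, f_of_top hM hx h1⟩
  · right
    have h2 : M < Nat.find h := by
      by_contra! h3
      exact absurd ((Nat.find_spec h).trans (curve_mono_index h3 hx.1.le)) (by linarith)
    obtain ⟨m, hm⟩ : ∃ m, Nat.find h = m + 1 := ⟨Nat.find h - 1, by omega⟩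
    have h3 : curve m x < l := by
      have := Nat.find_min h (m := m) (by omega)
      linarith
    have h4 : l ≤ curve (m + 1) x := hm ▸ Nat.find_spec h
    exact ⟨m, by omega, h3, h4, f_of_between hx h3 h4 (hM.le_of_le (by omega))⟩

lemma f_zero (l : ℝ) : f 0 l = 0 := by simp [f]

lemma chord_le_one_div {m : ℕ} {x l : ℝ} (h0 : 0 < l) (h1 : l ≤ m + 2) (hx : x ≤ alp m l) :
    chord m l x ≤ 1 / 2 ^ m := by
  have := slope_pos m h0 h1
  rw [chord]
  nlinarith

lemma one_div_le_chord {m : ℕ} {x l : ℝ} (h0 : 0 < l) (h1 : l ≤ m + 2) (hx : alp (m + 1) l ≤ x) :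
    1 / 2 ^ (m + 1) ≤ chord m l x := by
  have := slope_pos m h0 h1
  rw [chord_eq m h0 h1]
  nlinarith

lemma f_le_top {M : ℕ} {x l : ℝ} (hM : IsTop M l) (hx : x ∈ Icc (0 : ℝ) 1) : f x l ≤ 1 / 2 ^ M := by
  rcases hx.1.eq_or_lt with rfl | h0
  · rw [f_zero]
    positivity
  rcases f_cases hM ⟨h0, hx.2⟩ with ⟨-, h⟩ | ⟨m, hm, h1, h2, h⟩
  · exact h.le
  · have hl := hM.le_of_le hm
    rw [h]
    refine (chord_le_one_div hM.1 hl ((lt_alp_iff m hM.1.le hl hx).2 h1).le).trans ?_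
    gcongr
    norm_num

lemma le_f {m : ℕ} {x l : ℝ} (h0 : 0 < l) (hx : x ∈ Ioc (0 : ℝ) 1) (h : l ≤ curve m x) :
    1 / 2 ^ m ≤ f x l := by
  obtain ⟨M, hM⟩ := exists_isTop h0
  have hmM : M ≤ m := by
    by_contra! h3
    exact absurd (hM.curve_lt (Ioc_subset_Icc_self hx) h3) (by linarith)
  rcases f_cases hM hx with ⟨-, h'⟩ | ⟨n, hn, h1, h2, h'⟩
  · rw [h']
    gcongr
    norm_num
  · have hl := hM.le_of_le hn
    have hnm : n < m := by
      by_contra! h3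
      exact absurd (curve_mono_index h3 hx.1.le) (by linarith)
    rw [h']
    refine le_trans ?_ (one_div_le_chord h0 hl ((alp_le_iff (n + 1) h0.le (by push_cast; linarith)
      (Ioc_subset_Icc_self hx)).2 h2))
    gcongr
    · norm_num
    · exact hnm

/-- By `two_mul_alp_succ_le` the gap to the right of `alp (m + 1) l` is at least that abscissa.
After homogenisation the intercept becomes the coefficient of `A`. -/
lemma chord_zero_nonneg {m : ℕ} {l : ℝ} (h0 : 0 < l) (h1 : l ≤ m + 2) : 0 ≤ chord m l 0 := by
  have h2 := slope_mul m h0 h1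
  have h3 := slope_pos m h0 h1
  have h4 := two_mul_alp_succ_le m h0.le h1
  rw [chord_eq m h0 h1]
  nlinarith

/-- Monotone slopes put every chord above the graph outside its own strip. -/
lemma f_le_chord {M m : ℕ} {x l : ℝ} (hM : IsTop M l) (hm : M ≤ m) (hx : x ∈ Icc (0 : ℝ) 1) :
    f x l ≤ chord m l x := by
  have h0 := hM.1
  rcases hx.1.eq_or_lt with rfl | hx0
  · rw [f_zero]
    exact chord_zero_nonneg h0 (hM.le_of_le hm)
  rcases f_cases hM ⟨hx0, hx.2⟩ with ⟨h1, h⟩ | ⟨n, hn, h1, h2, h⟩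
  · have h2 := (alp_le_iff M h0.le hM.2.1 hx).2 h1
    have h3 := slope_pos M h0 hM.2.1
    rw [h]
    refine le_trans ?_ (chord_le_of_alp_le hm h0 hM.2.1 ((alp_succ_lt M h0 hM.2.1).le.trans h2))
    rw [chord]
    nlinarith
  · have hl := hM.le_of_le hn
    rw [h]
    rcases le_total m n with hmn | hmn
    · exact chord_le_of_le_alp hmn h0 (hM.le_of_le hm) ((lt_alp_iff n h0.le hl hx).2 h1).le
    · exact chord_le_of_alp_le hmn h0 hl ((alp_le_iff (n + 1) h0.le (by push_cast; linarith) hx).2 h2)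

lemma f_nonneg {x l : ℝ} (h0 : 0 < l) (hx : x ∈ Icc (0 : ℝ) 1) : 0 ≤ f x l := by
  rcases hx.1.eq_or_lt with rfl | hx0
  · rw [f_zero]
  obtain ⟨m, hm⟩ := exists_le_curve hx0 hx.2 l
  exact le_trans (by positivity) (le_f h0 ⟨hx0, hx.2⟩ hm)

lemma f_le_one {x l : ℝ} (h0 : 0 < l) (hx : x ∈ Icc (0 : ℝ) 1) : f x l ≤ 1 := by
  obtain ⟨M, hM⟩ := exists_isTop h0
  exact (f_le_top hM hx).trans (div_le_one_of_le₀ (one_le_pow₀ one_le_two) (by positivity))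

lemma f_of_le_two_mul {x l : ℝ} (h0 : 0 < l) (hx : x ∈ Ioc (0 : ℝ) 1) (h : l ≤ 2 * x) :
    f x l = 1 := by
  rw [f_of_top (M := 0) ⟨h0, by simp; linarith [hx.2], Or.inl rfl⟩ hx
    (by rwa [curve_zero (Ioc_subset_Icc_self hx)])]
  simp

lemma f_one_eq {M : ℕ} {l : ℝ} (hM : IsTop M l) : f 1 l = 1 / 2 ^ M :=
  f_of_top hM (by simp) (by rw [curve_at_one]; exact hM.2.1)

lemma f_le_f_one {x l : ℝ} (h0 : 0 < l) (hx : x ∈ Icc (0 : ℝ) 1) : f x l ≤ f 1 l := by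
  obtain ⟨M, hM⟩ := exists_isTop h0
  rw [f_one_eq hM]
  exact f_le_top hM hx

/-- The function `𝐟` has nondecreasing supporting lines. -/
lemma f_support {x l : ℝ} (h0 : 0 < l) (hx : x ∈ Ioc (0 : ℝ) 1) :
    ∃ p r, 0 ≤ p ∧ f x l = r + p * x ∧ ∀ y ∈ Icc (0 : ℝ) 1, f y l ≤ r + p * y := by
  obtain ⟨M, hM⟩ := exists_isTop h0
  rcases f_cases hM hx with ⟨-, h⟩ | ⟨m, hm, -, -, h⟩
  · exact ⟨0, 1 / 2 ^ M, le_rfl, by simpa using h, fun y hy => by simpa using f_le_top hM hy⟩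
  · refine ⟨slope m l, 1 / 2 ^ m - slope m l * alp m l, (slope_pos m h0 (hM.le_of_le hm)).le,
      by rw [h, chord]; ring, fun y hy => (f_le_chord hM hm hy).trans_eq (by rw [chord]; ring)⟩

/-- If a curve separates the two levels at `x`, its value `1 / 2 ^ m` separates the values of `f`.
Otherwise both points lie in one strip, whose two ends move right as the level grows. -/
lemma f_antitone {x l l' : ℝ} (h0 : 0 < l) (h : l ≤ l') (hx : x ∈ Icc (0 : ℝ) 1) :
    f x l' ≤ f x l := by
  rcases hx.1.eq_or_lt with rfl | hx0
  · simp [f_zero]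
  have hx' : x ∈ Ioc (0 : ℝ) 1 := ⟨hx0, hx.2⟩
  obtain ⟨M, hM⟩ := exists_isTop (h0.trans_le h)
  rcases f_cases hM hx' with ⟨h1, h'⟩ | ⟨m, hm, h1, h2, h'⟩
  · rw [h']
    exact le_f h0 hx' (h.trans h1)
  · have hl' := hM.le_of_le hm
    have hxa := (lt_alp_iff m hM.1.le hl' hx).2 h1
    rcases le_or_gt l (curve m x) with h3 | h3
    · rw [h']
      exact (chord_le_one_div hM.1 hl' hxa.le).trans (le_f h0 hx' h3)
    · rw [h', f_of_between hx' h3 (h.trans h2) (h.trans hl'), chord, chord, slope, slope]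
      have e1 := alp_mono m h0.le h hl'
      have e2 := alp_mono (m + 1) h0.le h (l' := l') (by push_cast; linarith)
      have e3 := alp_succ_lt m h0 (h.trans hl')
      have e4 := alp_succ_lt m hM.1 hl'
      have e5 := (lt_alp_iff m h0.le (h.trans hl') hx).2 h3
      have e6 := (alp_le_iff (m + 1) hM.1.le (by push_cast; linarith) hx).2 h2
      -- For `b ≤ x ≤ c` the quotient `(c - x) / (c - b)` increases in both `b` and `c`.
      have key : (alp m l - x) / (alp m l - alp (m + 1) l) ≤
          (alp m l' - x) / (alp m l' - alp (m + 1) l') := by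
        rw [div_le_div_iff₀ (by linarith) (by linarith)]
        nlinarith
      have hp : (0 : ℝ) < 1 / 2 ^ (m + 1) := by positivity
      have := mul_le_mul_of_nonneg_left key hp.le
      have r : ∀ u v w c : ℝ, c / (u - v) * (w - u) = -(c * ((u - w) / (u - v))) := by
        intros
        ring
      rw [r, r]
      linarith

/-- Each index `M` occupies an interval of levels closed on the right, so it is stable only from the
left. -/
lemma eventually_isTop {M : ℕ} {l : ℝ} (hM : IsTop M l) :
    ∀ᶠ l' in nhdsWithin l (Iio l), IsTop M l' := by
  have h1 : ∀ c < l, ∀ᶠ l' in nhdsWithin l (Iio l), c < l' := fun c hc =>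
    Filter.Eventually.filter_mono nhdsWithin_le_nhds (eventually_gt_nhds hc)
  rcases hM.2.2 with h | h
  · filter_upwards [h1 0 hM.1, self_mem_nhdsWithin] with l' h2 h3
    exact ⟨h2, h3.le.trans hM.2.1, Or.inl h⟩
  · filter_upwards [h1 0 hM.1, h1 _ h, self_mem_nhdsWithin] with l' h2 h2' h3
    exact ⟨h2, h3.le.trans hM.2.1, Or.inr h2'⟩

lemma tendsto_alp {m : ℕ} {l : ℝ} (h0 : 0 < l) (h1 : l ≤ m + 2) :
    Filter.Tendsto (alp m) (nhdsWithin l (Iio l)) (nhds (alp m l)) := by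
  have h : Filter.Tendsto (fun l' => alp m l - (l - l')) (nhdsWithin l (Iio l)) (nhds (alp m l)) := by
    have : Continuous fun l' => alp m l - (l - l') := by fun_prop
    have := this.tendsto l
    simp only [sub_self, sub_zero] at this
    exact this.mono_left nhdsWithin_le_nhds
  have hpos : ∀ᶠ l' in nhdsWithin l (Iio l), 0 < l' :=
    Filter.Eventually.filter_mono nhdsWithin_le_nhds (eventually_gt_nhds h0)
  refine tendsto_of_tendsto_of_tendsto_of_le_of_le' h tendsto_const_nhds ?_ ?_
  · filter_upwards [hpos, self_mem_nhdsWithin] with l' h2 h3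
    have := alp_sub_le m h2.le (le_of_lt h3) h1
    linarith
  · filter_upwards [hpos, self_mem_nhdsWithin] with l' h2 h3
    exact alp_mono m h2.le (le_of_lt h3) h1

/-- The chord with the index chosen at `l` varies continuously from the left and remains an upper
bound by `f_le_chord`, whether or not `x` changes strip. -/
lemma eventually_f_le {x l ε : ℝ} (h0 : 0 < l) (hx : x ∈ Icc (0 : ℝ) 1) (hε : 0 < ε) :
    ∀ᶠ l' in nhdsWithin l (Iio l), f x l' ≤ f x l + ε := by
  rcases hx.1.eq_or_lt with rfl | hx0
  · simp [f_zero, hε.le]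
  obtain ⟨M, hM⟩ := exists_isTop h0
  rcases f_cases hM ⟨hx0, hx.2⟩ with ⟨-, h⟩ | ⟨m, hm, -, -, h⟩
  · filter_upwards [eventually_isTop hM] with l' h1
    rw [h]
    linarith [f_le_top h1 hx]
  · have hl := hM.le_of_le hm
    have t1 := tendsto_alp h0 hl
    have t2 := tendsto_alp (m := m + 1) h0 (by push_cast; linarith)
    have h3 := alp_succ_lt m h0 hl
    have t : Filter.Tendsto (fun l' => chord m l' x) (nhdsWithin l (Iio l)) (nhds (chord m l x)) := by
      unfold chord slope
      exact tendsto_const_nhds.add ((tendsto_const_nhds.div (t1.sub t2) (by linarith)).mul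
        (tendsto_const_nhds.sub t1))
    filter_upwards [eventually_isTop hM, t.eventually_lt_const (show chord m l x < chord m l x + ε by
      linarith)] with l' h1 h2
    rw [h]
    exact (f_le_chord h1 hm hx).trans h2.le

/-! ### The jump inequality for `f`. -/

/-- Compares secant slopes on `[P, a]` and `[b, Q]` for two dilations of `profile`. If `2 ^ (m + 1)
* a ≤ 1`, the former is the maximal `3 * 2 ^ (m + 1)`. Otherwise `ha` and `hb` force `2 ^ m * b ≥
1`, the two dilations differ by the constant `1` on `[b, Q]`, and concavity decides. -/
lemma profile_chord_le {m : ℕ} {P a b Q l : ℝ} (hP : 0 ≤ P) (hPa : P < a) (hab : a < b) (hbQ : b < Q)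
    (ha : profile (2 ^ (m + 1) * a) = l + a) (hb : profile (2 ^ m * b) = l + b) :
    (profile (2 ^ m * Q) - profile (2 ^ m * b)) * (a - P) ≤
      (profile (2 ^ (m + 1) * a) - profile (2 ^ (m + 1) * P)) * (Q - b) := by
  have hp : (0 : ℝ) < 2 ^ m := by positivity
  have ha0 : 0 ≤ a := hP.trans hPa.le
  have hb0 : 0 ≤ b := ha0.trans hab.le
  rcases le_or_gt (2 ^ (m + 1) * a) 1 with h1 | h1
  · have e1 : profile (2 ^ (m + 1) * a) - profile (2 ^ (m + 1) * P) = 3 * 2 ^ (m + 1) * (a - P) := by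
      rw [profile_of_le_one (by positivity) h1, profile_of_le_one (by positivity)
        (le_trans (by gcongr) h1)]
      ring
    have e2 := profile_sub_le (x := 2 ^ m * b) (y := 2 ^ m * Q) (by positivity) (by gcongr)
    rw [e1]
    have e3 : 0 ≤ (a - P) * (Q - b) := mul_nonneg (by linarith) (by linarith)
    have e4 := mul_le_mul_of_nonneg_right e2 (show 0 ≤ a - P by linarith)
    refine e4.trans ?_
    rw [pow_succ]
    nlinarith [mul_nonneg hp.le e3]
  · have e1 : 3 ≤ l + a := by
      rw [← ha, ← mul_one (3 : ℝ), ← profile_of_le_one zero_le_one le_rfl]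
      exact profile_mono zero_le_one h1.le
    have e2 : 1 ≤ 2 ^ m * b := by
      by_contra! h2
      rw [profile_of_le_one (by positivity) h2.le] at hb
      linarith
    have e3 : 1 ≤ 2 ^ m * Q := e2.trans (by gcongr)
    have d : ∀ y, 1 ≤ 2 ^ m * y → profile (2 ^ m * y) = profile (2 ^ (m + 1) * y) - 1 := by
      intro y hy
      rw [pow_succ, mul_comm (2 ^ m : ℝ) 2, mul_assoc, profile_two_mul hy]
      ring
    rw [d b e2, d Q e3]
    have hq : (0 : ℝ) < 2 ^ (m + 1) := by positivity
    have m1 : ∀ y : ℝ, 0 ≤ y → 2 ^ (m + 1) * y ∈ Ici (0 : ℝ) := fun y hy => mul_nonneg hq.le hy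
    have s1 := profile_concave.slope_anti_adjacent (m1 P hP) (m1 b hb0)
      (mul_lt_mul_of_pos_left hPa hq) (mul_lt_mul_of_pos_left hab hq)
    have s2 := profile_concave.slope_anti_adjacent (m1 a ha0) (m1 Q (hb0.trans hbQ.le))
      (mul_lt_mul_of_pos_left hab hq) (mul_lt_mul_of_pos_left hbQ hq)
    have s := s2.trans s1
    simp only [← mul_sub] at s
    rw [div_le_div_iff₀ (mul_pos hq (by linarith)) (mul_pos hq (by linarith))] at s
    refine le_of_mul_le_mul_left ?_ hq
    linarith

/-- The jump inequality for `𝐟` in the region where it is homogeneous. -/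
lemma half_f_two_mul_le {u μ : ℝ} (hu0 : 0 < u) (hu : u ≤ 1 / 2) (hμ : 0 < μ) :
    f (2 * u) μ / 2 ≤ f u (μ + u) := by
  have h2u : 2 * u ∈ Ioc (0 : ℝ) 1 := ⟨by linarith, by linarith⟩
  have hu1 : u ∈ Ioc (0 : ℝ) 1 := ⟨hu0, by linarith⟩
  have hl : 0 < μ + u := by linarith
  obtain ⟨M, hM⟩ := exists_isTop hμ
  rcases f_cases hM h2u with ⟨h1, h⟩ | ⟨m, hm, h1, h2, h⟩
  · refine le_trans (le_of_eq ?_) (le_f (m := M + 1) hl hu1 (by rw [curve_succ]; linarith))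
    rw [h, pow_succ]
    field_simp
  · have hμm := hM.le_of_le hm
    have hlm : μ + u ≤ ((m + 1 : ℕ) : ℝ) + 2 := by push_cast; linarith
    have hlm2 : μ + u ≤ ((m + 1 + 1 : ℕ) : ℝ) + 2 := by push_cast; linarith
    have hμm1 : μ ≤ ((m + 1 : ℕ) : ℝ) + 2 := by push_cast; linarith
    have h1' : curve (m + 1) u < μ + u := by rw [curve_succ]; linarith
    have h2' : μ + u ≤ curve (m + 1 + 1) u := by rw [curve_succ]; linarith
    rw [h, f_of_between hu1 h1' h2' hlm]
    -- The left side interpolates between `P` and `Q`, the right side between `a` and `b`, with the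
    -- same end values; here `P ≤ a ≤ u < b < Q`.
    obtain ⟨P, hP⟩ : ∃ P, alp (m + 1) μ = 2 * P := ⟨alp (m + 1) μ / 2, by ring⟩
    obtain ⟨Q, hQ⟩ : ∃ Q, alp m μ = 2 * Q := ⟨alp m μ / 2, by ring⟩
    have hPm := alp_mem (m + 1) hμ.le hμm1
    have hQm := alp_mem m hμ.le hμm
    have cP := curve_alp (m + 1) hμ.le hμm1
    have cQ := curve_alp m hμ.le hμm
    have hPu := (alp_le_iff (m + 1) hμ.le hμm1 (Ioc_subset_Icc_self h2u)).2 h2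
    have hQu := (lt_alp_iff m hμ.le hμm (Ioc_subset_Icc_self h2u)).2 h1
    have ham := alp_mem (m + 1 + 1) hl.le hlm2
    have hbm := alp_mem (m + 1) hl.le hlm
    have ca := curve_alp (m + 1 + 1) hl.le hlm2
    have cb := curve_alp (m + 1) hl.le hlm
    have hau := (alp_le_iff (m + 1 + 1) hl.le hlm2 (Ioc_subset_Icc_self hu1)).2 h2'
    have hbu := (lt_alp_iff (m + 1) hl.le hlm (Ioc_subset_Icc_self hu1)).2 h1'
    rw [hP] at hPm cP hPu
    rw [hQ] at hQm cQ hQu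
    have hP1 : P ∈ Icc (0 : ℝ) 1 := ⟨by linarith [hPm.1], by linarith [hPm.1, hPm.2]⟩
    have hQ1 : Q ∈ Icc (0 : ℝ) 1 := ⟨by linarith [hQm.1], by linarith [hQm.1, hQm.2]⟩
    have hPa : P ≤ alp (m + 1 + 1) (μ + u) := by
      by_contra! hc
      have := (alp_le_iff (m + 1 + 1) hl.le hlm2 hP1).1 hc.le
      rw [curve_succ, cP] at this
      have := (curve_strictMonoOn (m + 1 + 1)) ham hP1 hc
      rw [ca, curve_succ, cP] at this
      linarith
    have hbQ : alp (m + 1) (μ + u) ≤ Q := by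
      rw [alp_le_iff (m + 1) hl.le hlm hQ1, curve_succ, cQ]
      linarith
    rw [chord_eq (m + 1) hl hlm, chord_eq m hμ hμm, slope, slope, hP, hQ]
    set a := alp (m + 1 + 1) (μ + u)
    set b := alp (m + 1) (μ + u)
    have gP : profile (2 ^ (m + 1 + 1) * P) = μ + 2 * P := by
      rw [curve] at cP
      rw [pow_succ, mul_assoc]
      linarith
    have gQ : profile (2 ^ (m + 1) * Q) = μ + 2 * Q := by
      rw [curve] at cQ
      rw [pow_succ, mul_assoc]
      linarith
    have ga : profile (2 ^ (m + 1 + 1) * a) = μ + u + a := by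
      rw [curve] at ca
      linarith
    have gb : profile (2 ^ (m + 1) * b) = μ + u + b := by
      rw [curve] at cb
      linarith
    have hbQ' : b < Q := by
      refine hbQ.lt_of_ne fun hc => ?_
      rw [hc, gQ] at gb
      linarith
    -- The profile increments are `(u - P) + (a - P)` and `(Q - u) + (Q - b)`; in `profile_chord_le`
    -- the product `(a - P) * (Q - b)` cancels.
    have key : (Q - u) * (a - P) ≤ (u - P) * (Q - b) := by
      rcases hPa.eq_or_lt with hc | hc
      · rw [← hc]
        nlinarith
      · have := profile_chord_le hP1.1 hc (hau.trans_lt hbu) hbQ' ga gb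
        rw [gP, gQ, ga, gb] at this
        nlinarith
    have key2 : (u - P) / (Q - P) ≤ (u - a) / (b - a) := by
      rw [div_le_div_iff₀ (by linarith) (by linarith)]
      nlinarith
    have e1 : (1 / 2 ^ (m + 1) + 1 / 2 ^ (m + 1) / (2 * Q - 2 * P) * (2 * u - 2 * P)) / 2 =
        1 / 2 ^ (m + 1 + 1) * (1 + (u - P) / (Q - P)) := by
      have : Q - P ≠ 0 := by linarith
      have h2 : 2 * Q - 2 * P ≠ 0 := by linarith
      rw [pow_succ _ (m + 1)]
      field_simp
    have e2 : 1 / 2 ^ (m + 1 + 1) + 1 / 2 ^ (m + 1 + 1) / (b - a) * (u - a) =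
        1 / 2 ^ (m + 1 + 1) * (1 + (u - a) / (b - a)) := by
      have : b - a ≠ 0 := by linarith
      field_simp
    rw [e1, e2]
    gcongr

lemma half_f_one_le {u μ : ℝ} (hu0 : 1 / 2 ≤ u) (hu : u ≤ 1) (hμ : 0 < μ) :
    f 1 μ / 2 ≤ f u (μ + u) := by
  obtain ⟨M, hM⟩ := exists_isTop hμ
  rw [f_one_eq hM]
  refine le_trans (le_of_eq ?_) (le_f (m := M + 1) (by linarith) ⟨by linarith, hu⟩ ?_)
  · rw [pow_succ]
    field_simp
  · rw [curve_succ_of_ge M hu0 hu]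
    linarith [hM.2.1]

lemma alp_zero {l : ℝ} (h0 : 0 ≤ l) (h1 : l ≤ 2) : alp 0 l = l / 2 := by
  have hm : l / 2 ∈ Icc (0 : ℝ) 1 := ⟨by linarith, by linarith⟩
  have := alp_curve 0 hm
  rwa [curve_zero hm, mul_div_cancel₀ _ two_ne_zero] at this

lemma alp_one {l : ℝ} (h0 : 0 ≤ l) (h1 : l ≤ 2) : alp 1 l = l / 5 := by
  have hm : l / 5 ∈ Icc (0 : ℝ) 1 := ⟨by linarith, by linarith⟩
  have := alp_curve 1 hm
  rw [curve_succ, curve_zero ⟨by linarith, by linarith⟩] at this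
  rwa [show 2 * (2 * (l / 5)) + l / 5 = l by ring] at this

lemma slope_zero {l : ℝ} (h0 : 0 < l) (h1 : l ≤ 2) : slope 0 l = 5 / (3 * l) := by
  rw [slope, alp_zero h0.le h1, alp_one h0.le h1, show l / 2 - l / 5 = 3 * l / 10 by ring]
  field_simp
  norm_num

/-- The jump out of the middle triangle at height `1`. The difference of the two sides vanishes on
both edges `u = μ` and `4 * u = μ`, hence the factorisation in the proof. -/
lemma le_f_low {u μ : ℝ} (hu : u ∈ Ioc (0 : ℝ) 1) (h1 : u < μ) (h2 : μ ≤ 1) (h3 : μ ≤ 4 * u) :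
    (1 + 2 * u / μ) / 3 ≤ f u (μ + u) := by
  have hu' := Ioc_subset_Icc_self hu
  have hμ : 0 < μ := hu.1.trans h1
  have hl : μ + u ≤ 2 := by linarith [hu.2]
  have c : μ + u ≤ curve (0 + 1) u := by
    rcases le_total u (1 / 2) with h | h
    · rw [curve_succ, curve_zero ⟨by linarith [hu.1], by linarith⟩]
      linarith
    · rw [curve_succ_of_ge 0 h hu.2]
      push_cast
      linarith
  rw [f_of_between hu (by rw [curve_zero hu']; linarith) c (by simpa using hl), chord,
    slope_zero (by linarith) hl, alp_zero (by linarith) hl]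
  have : 1 / 2 ^ 0 + 5 / (3 * (μ + u)) * (u - (μ + u) / 2) - (1 + 2 * u / μ) / 3 =
      (μ - u) * (4 * u - μ) / (6 * μ * (μ + u)) := by
    have : μ + u ≠ 0 := by linarith [hu.1]
    field_simp
    ring
  have h5 : 0 ≤ (μ - u) * (4 * u - μ) / (6 * μ * (μ + u)) :=
    div_nonneg (mul_nonneg (by linarith) (by linarith))
      (mul_nonneg (by linarith) (by linarith [hu.1]))
  linarith

/-! ### The polygons -/

lemma le_of_mem_convexHull {s : Set (ℝ × ℝ)} {c₁ c₂ c : ℝ} (h : ∀ p ∈ s, c₁ * p.1 + c₂ * p.2 ≤ c)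
    {p : ℝ × ℝ} (hp : p ∈ convexHull ℝ s) : c₁ * p.1 + c₂ * p.2 ≤ c := by
  have hc : Convex ℝ {p : ℝ × ℝ | c₁ * p.1 + c₂ * p.2 ≤ c} := by
    intro p hp q hq a b ha hb hab
    simp only [mem_ofPred_eq, Prod.fst_add, Prod.snd_add, Prod.smul_fst, Prod.smul_snd,
      smul_eq_mul] at *
    obtain rfl : b = 1 - a := by linarith
    nlinarith
  exact convexHull_min h hc hp

lemma mem_of_horizontal {C : Set (ℝ × ℝ)} (hC : Convex ℝ C) {a b x y : ℝ} (ha : (a, y) ∈ C)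
    (hb : (b, y) ∈ C) (h1 : a ≤ x) (h2 : x ≤ b) : (x, y) ∈ C := by
  have hx : x ∈ segment ℝ a b := by
    rw [segment_eq_Icc (h1.trans h2)]
    exact ⟨h1, h2⟩
  obtain ⟨s, t, hs, ht, hst, rfl⟩ := hx
  have := hC ha hb hs ht hst
  simpa [← add_mul, hst] using this

lemma combo_mem {C : Set (ℝ × ℝ)} (hC : Convex ℝ C) {p q r : ℝ × ℝ} (hp : p ∈ C) (hq : q ∈ C) (t : ℝ)
    (h0 : 0 ≤ t) (h1 : t ≤ 1) (h : r = ((1 - t) * p.1 + t * q.1, (1 - t) * p.2 + t * q.2)) :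
    r ∈ C := by
  have := hC hp hq (sub_nonneg.2 h1) h0 (by ring)
  rw [h]
  exact this

lemma mem_Sigma0'_iff {x A l : ℝ} (hl : l ∈ Ioc (0 : ℝ) 1) :
    (x, A) ∈ Sigma0' l ↔ 1 ≤ A ∧ A ≤ 2 ∧ x ≤ 1 ∧ 3 * l ≤ 2 * x + l * A := by
  obtain ⟨h0, h1⟩ := hl
  constructor
  · intro h
    have e1 := le_of_mem_convexHull (c₁ := 0) (c₂ := -1) (c := -1) (by simp) h
    have e2 := le_of_mem_convexHull (c₁ := 0) (c₂ := 1) (c := 2) (by simp) h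
    have e3 := le_of_mem_convexHull (c₁ := 1) (c₂ := 0) (c := 1)
      (by simp; constructor <;> linarith) h
    have e4 := le_of_mem_convexHull (c₁ := -2) (c₂ := -l) (c := -(3 * l))
      (by simp; refine ⟨?_, ?_, ?_, ?_⟩ <;> linarith) h
    simp only at e1 e2 e3 e4
    refine ⟨?_, ?_, ?_, ?_⟩ <;> linarith
  · rintro ⟨h2, h3, h4, h5⟩
    have hC : Convex ℝ (Sigma0' l) := convex_convexHull ℝ _
    have v : ∀ p ∈ ({(l / 2, 2), (l, 1), (1, 1), (1, 2)} : Set (ℝ × ℝ)), p ∈ Sigma0' l :=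
      fun p hp => subset_convexHull ℝ _ hp
    refine mem_of_horizontal hC (a := (3 * l - l * A) / 2) (b := 1) ?_ ?_ (by linarith) h4
    · exact combo_mem hC (v (l, 1) (by simp)) (v (l / 2, 2) (by simp)) (A - 1) (by linarith)
        (by linarith) (by ext <;> simp <;> ring)
    · exact combo_mem hC (v (1, 1) (by simp)) (v (1, 2) (by simp)) (A - 1) (by linarith)
        (by linarith) (by ext <;> simp; ring)

lemma mem_Sigma1_iff {x A l : ℝ} (hl : l ∈ Ioc (0 : ℝ) 1) :
    (x, A) ∈ Sigma1 l ↔ 0 ≤ A ∧ A ≤ 1 ∧ x ≤ 1 ∧ l * A ≤ x := by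
  obtain ⟨h0, h1⟩ := hl
  constructor
  · intro h
    have e1 := le_of_mem_convexHull (c₁ := 0) (c₂ := -1) (c := 0) (by simp) h
    have e2 := le_of_mem_convexHull (c₁ := 0) (c₂ := 1) (c := 1) (by simp) h
    have e3 := le_of_mem_convexHull (c₁ := 1) (c₂ := 0) (c := 1) (by simp; linarith) h
    have e4 := le_of_mem_convexHull (c₁ := -1) (c₂ := l) (c := 0) (by simp; linarith) h
    simp only at e1 e2 e3 e4
    refine ⟨?_, ?_, ?_, ?_⟩ <;> linarith
  · rintro ⟨h2, h3, h4, h5⟩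
    have hC : Convex ℝ (Sigma1 l) := convex_convexHull ℝ _
    have v : ∀ p ∈ ({(0, 0), (1, 0), (1, 1), (l, 1)} : Set (ℝ × ℝ)), p ∈ Sigma1 l :=
      fun p hp => subset_convexHull ℝ _ hp
    refine mem_of_horizontal hC (a := l * A) (b := 1) ?_ ?_ h5 h4
    · exact combo_mem hC (v (0, 0) (by simp)) (v (l, 1) (by simp)) A h2 h3
        (by ext <;> simp; ring)
    · exact combo_mem hC (v (1, 0) (by simp)) (v (1, 1) (by simp)) A h2 h3 (by ext <;> simp)

lemma mem_Sigma0_iff {x A l : ℝ} (hl : l ∈ Ioc (0 : ℝ) 1) :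
    (x, A) ∈ Sigma0 l ↔ x ≤ l * A ∧ l * A ≤ 4 * x ∧ 2 * x + l * A ≤ 3 * l := by
  obtain ⟨h0, h1⟩ := hl
  constructor
  · intro h
    have e1 := le_of_mem_convexHull (c₁ := 1) (c₂ := -l) (c := 0)
      (by simp; linarith) h
    have e2 := le_of_mem_convexHull (c₁ := -4) (c₂ := l) (c := 0)
      (by simp; constructor <;> linarith) h
    have e3 := le_of_mem_convexHull (c₁ := 2) (c₂ := l) (c := 3 * l)
      (by simp; refine ⟨?_, ?_, ?_⟩ <;> linarith) h
    simp only at e1 e2 e3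
    refine ⟨?_, ?_, ?_⟩ <;> linarith
  · rintro ⟨h2, h3, h4⟩
    have hx : 0 ≤ x := by linarith
    have hA0 : 0 ≤ A := by
      by_contra! h
      nlinarith
    have hA2 : A ≤ 2 := by
      by_contra! h
      nlinarith
    have hC : Convex ℝ (Sigma0 l) := convex_convexHull ℝ _
    have v : ∀ p ∈ ({(0, 0), (l, 1), (l / 2, 2)} : Set (ℝ × ℝ)), p ∈ Sigma0 l :=
      fun p hp => subset_convexHull ℝ _ hp
    have left : (l * A / 4, A) ∈ Sigma0 l :=
      combo_mem hC (v (0, 0) (by simp)) (v (l / 2, 2) (by simp)) (A / 2) (by linarith)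
        (by linarith) (by ext <;> simp; ring)
    rcases le_total A 1 with h | h
    · exact mem_of_horizontal hC left (combo_mem hC (v (0, 0) (by simp)) (v (l, 1) (by simp)) A hA0 h
        (show (l * A, A) = _ by ext <;> simp; ring)) (by linarith) h2
    · exact mem_of_horizontal hC left (combo_mem hC (v (l, 1) (by simp)) (v (l / 2, 2) (by simp))
        (A - 1) (by linarith) (by linarith)
        (show ((3 * l - l * A) / 2, A) = _ by ext <;> simp <;> ring)) (by linarith) (by linarith)

/-! ### The explicit function on the polygons -/

lemma candidate_of_nonpos {x A l : ℝ} (hl : l ≤ 0) : candidate x A l = 1 := if_pos hl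

lemma candidate_of_one_lt {x A l : ℝ} (hl : 1 < l) (h : 2 * x ≤ A) :
    candidate x A l = A / 2 * f (2 * x / A) l := by
  rw [candidate, if_neg (by linarith), if_neg (by linarith), if_pos h]

lemma candidate_of_one_lt' {x A l : ℝ} (hl : 1 < l) (h : A ≤ 2 * x) :
    candidate x A l = A / 2 * f 1 l := by
  rw [candidate, if_neg (by linarith), if_neg (by linarith)]
  split_ifs with h'
  · obtain rfl : A = 2 * x := le_antisymm h h'
    rcases eq_or_ne (2 * x) 0 with h0 | h0
    · simp [h0]
    · rw [div_self h0]
  · rfl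

lemma candidate_upper {x A l : ℝ} (hl : l ∈ Ioc (0 : ℝ) 1) (hx : x ∈ Icc (0 : ℝ) 1)
    (hA : A ∈ Icc (0 : ℝ) 2) (h1 : 1 ≤ A) (h2 : 3 * l ≤ 2 * x + l * A) : candidate x A l = 1 := by
  rw [candidate, if_neg (by linarith [hl.1]), if_pos hl.2,
    if_pos ((mem_Sigma0'_iff hl).2 ⟨h1, hA.2, hx.2, h2⟩)]

lemma candidate_lower {x A l : ℝ} (hl : l ∈ Ioc (0 : ℝ) 1) (hx : x ∈ Icc (0 : ℝ) 1)
    (hA : A ∈ Icc (0 : ℝ) 2) (h1 : A ≤ 1) (h2 : l * A ≤ x) : candidate x A l = A := by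
  rw [candidate, if_neg (by linarith [hl.1]), if_pos hl.2, mem_Sigma0'_iff hl,
    if_pos ((mem_Sigma1_iff hl).2 ⟨hA.1, h1, hx.2, h2⟩)]
  split_ifs with h
  · linarith [h.1]
  · rfl

/-- The branches tested earlier meet this triangle only along edges, where the formulas agree. -/
lemma candidate_middle {x A l : ℝ} (hl : l ∈ Ioc (0 : ℝ) 1) (h1 : x ≤ l * A) (h2 : l * A ≤ 4 * x)
    (h3 : 2 * x + l * A ≤ 3 * l) : candidate x A l = (A + 2 * x / l) / 3 := by
  have h0 := hl.1
  rw [candidate, if_neg (by linarith), if_pos hl.2, mem_Sigma0'_iff hl, mem_Sigma1_iff hl,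
    if_pos ((mem_Sigma0_iff hl).2 ⟨h1, h2, h3⟩)]
  split_ifs with h h'
  · have : 2 * x = 3 * l - l * A := by linarith [h.2.2.2]
    rw [this]
    field_simp
    ring
  · have : x = l * A := by linarith [h'.2.2.2]
    rw [this]
    field_simp
    ring
  · rfl

lemma candidate_left {x A l : ℝ} (hl : l ∈ Ioc (0 : ℝ) 1)
    (hA : A ∈ Icc (0 : ℝ) 2) (h : 4 * x ≤ l * A) :
    candidate x A l = A / 2 * f (2 * x / A) l := by
  have h0 := hl.1
  have hf : 4 * x = l * A → A / 2 * f (2 * x / A) l = A / 2 := by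
    intro h1
    rcases hA.1.eq_or_lt with rfl | h2
    · simp
    · rw [show 2 * x / A = l / 2 by field_simp; linarith,
        f_of_le_two_mul h0 ⟨by linarith, by linarith [hl.2]⟩ (by linarith), mul_one]
  rw [candidate, if_neg (by linarith), if_pos hl.2, mem_Sigma0'_iff hl, mem_Sigma1_iff hl,
    mem_Sigma0_iff hl]
  split_ifs with h1 h2 h3
  · obtain rfl : A = 2 := by
      refine le_antisymm hA.2 (le_of_mul_le_mul_left ?_ h0)
      linarith [h1.2.2.2]
    rw [hf (by linarith [h1.2.2.2])]
    norm_num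
  · obtain rfl : A = 0 := by
      refine le_antisymm (le_of_mul_le_mul_left ?_ h0) hA.1
      linarith [h2.2.2.2]
    simp
  · have h4 : l * A = 4 * x := le_antisymm h3.2.1 h
    rw [hf h4.symm]
    rw [show 2 * x = l * A / 2 by linarith]
    field_simp
    ring
  · rfl

lemma region_cases {x A l : ℝ} (hl : l ∈ Ioc (0 : ℝ) 1) :
    (1 ≤ A ∧ 3 * l ≤ 2 * x + l * A) ∨ (A ≤ 1 ∧ l * A ≤ x) ∨
      (x ≤ l * A ∧ l * A ≤ 4 * x ∧ 2 * x + l * A ≤ 3 * l) ∨ 4 * x < l * A := by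
  have h0 := hl.1
  rcases lt_or_ge (4 * x) (l * A) with h1 | h1
  · tauto
  rcases le_total A 1 with h2 | h2
  · rcases le_total (l * A) x with h3 | h3
    · tauto
    · refine Or.inr (Or.inr (Or.inl ⟨h3, h1, ?_⟩))
      nlinarith
  · rcases le_total (3 * l) (2 * x + l * A) with h3 | h3
    · tauto
    · refine Or.inr (Or.inr (Or.inl ⟨?_, h1, h3⟩))
      nlinarith

lemma ratio_mem {x A : ℝ} (hx : 0 ≤ x) (hA : 0 ≤ A) (h : 2 * x ≤ A) : 2 * x / A ∈ Icc (0 : ℝ) 1 :=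
  ⟨by positivity, div_le_one_of_le₀ h hA⟩

lemma mul_ratio {x A : ℝ} (hx : 0 ≤ x) (h : 2 * x ≤ A) : A / 2 * (2 * x / A) = x := by
  rcases eq_or_ne A 0 with rfl | hA
  · rw [zero_div, zero_mul]
    linarith
  · field_simp

/-- A line above `𝐟` gives a linear function above its homogeneous extension. -/
lemma homogeneous_le {x A l p r : ℝ} (hx : 0 ≤ x) (hA : 0 ≤ A) (h : 2 * x ≤ A)
    (hf : ∀ y ∈ Icc (0 : ℝ) 1, f y l ≤ r + p * y) : A / 2 * f (2 * x / A) l ≤ p * x + r / 2 * A := by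
  have h1 := mul_le_mul_of_nonneg_left (hf _ (ratio_mem hx hA h)) (show 0 ≤ A / 2 by linarith)
  have h2 := mul_ratio hx h
  have : A / 2 * (r + p * (2 * x / A)) = p * (A / 2 * (2 * x / A)) + r / 2 * A := by ring
  rw [this, h2] at h1
  exact h1

lemma homogeneous_eq {x A l p r : ℝ} (hx : 0 ≤ x) (h : 2 * x ≤ A)
    (hf : f (2 * x / A) l = r + p * (2 * x / A)) :
    A / 2 * f (2 * x / A) l = p * x + r / 2 * A := by
  have h2 := mul_ratio hx h
  have : A / 2 * (r + p * (2 * x / A)) = p * (A / 2 * (2 * x / A)) + r / 2 * A := by ring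
  rw [hf, this, h2]

lemma two_mul_le_of_left {x A l : ℝ} (hl : l ∈ Ioc (0 : ℝ) 1) (hA : 0 ≤ A)
    (h : 4 * x ≤ l * A) : 2 * x ≤ A := by
  have := hl.2
  nlinarith

lemma homogeneous_le_half {x A l : ℝ} (h0 : 0 < l) (hx : 0 ≤ x) (hA : 0 ≤ A) (h : 2 * x ≤ A) :
    A / 2 * f (2 * x / A) l ≤ A / 2 * f 1 l :=
  mul_le_mul_of_nonneg_left (f_le_f_one h0 (ratio_mem hx hA h)) (by linarith)

lemma candidate_le_half_f_one {x A l : ℝ} (hl : 1 < l) (hx : x ∈ Icc (0 : ℝ) 1)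
    (hA : A ∈ Icc (0 : ℝ) 2) : candidate x A l ≤ A / 2 * f 1 l := by
  rcases le_total (2 * x) A with h | h
  · rw [candidate_of_one_lt hl h]
    exact homogeneous_le_half (by linarith) hx.1 hA.1 h
  · rw [candidate_of_one_lt' hl h]

lemma half_mul_f_one_le {A l : ℝ} (h0 : 0 < l) (hA : 0 ≤ A) : A / 2 * f 1 l ≤ A / 2 := by
  have := f_le_one h0 (show (1 : ℝ) ∈ Icc (0 : ℝ) 1 by simp)
  nlinarith

lemma candidate_le_half {x A l : ℝ} (hl : 1 < l) (hx : x ∈ Icc (0 : ℝ) 1)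
    (hA : A ∈ Icc (0 : ℝ) 2) : candidate x A l ≤ A / 2 :=
  (candidate_le_half_f_one hl hx hA).trans (half_mul_f_one_le (by linarith) hA.1)

lemma candidate_left_le_half {x A l : ℝ} (hl : l ∈ Ioc (0 : ℝ) 1) (hx : x ∈ Icc (0 : ℝ) 1)
    (hA : A ∈ Icc (0 : ℝ) 2) (h : 4 * x ≤ l * A) : candidate x A l ≤ A / 2 := by
  rw [candidate_left hl hA h]
  exact (homogeneous_le_half hl.1 hx.1 hA.1 (two_mul_le_of_left hl hA.1 h)).trans
    (half_mul_f_one_le hl.1 hA.1)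

lemma candidate_nonneg {x A l : ℝ} (hx : x ∈ Icc (0 : ℝ) 1) (hA : A ∈ Icc (0 : ℝ) 2) :
    0 ≤ candidate x A l := by
  rcases le_or_gt l 0 with h0 | h0
  · rw [candidate_of_nonpos h0]
    exact zero_le_one
  have hx0 := hx.1
  have hA0 := hA.1
  rcases le_or_gt l 1 with h1 | h1
  · have hl : l ∈ Ioc (0 : ℝ) 1 := ⟨h0, h1⟩
    rcases region_cases (x := x) (A := A) hl with ⟨a, b⟩ | ⟨a, b⟩ | ⟨a, b, d⟩ | a
    · rw [candidate_upper hl hx hA a b]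
      exact zero_le_one
    · rwa [candidate_lower hl hx hA a b]
    · rw [candidate_middle hl a b d]
      positivity
    · rw [candidate_left hl hA a.le]
      exact mul_nonneg (by linarith)
        (f_nonneg h0 (ratio_mem hx0 hA0 (two_mul_le_of_left hl hA0 a.le)))
  · rcases le_total (2 * x) A with h | h
    · rw [candidate_of_one_lt h1 h]
      exact mul_nonneg (by linarith) (f_nonneg h0 (ratio_mem hx0 hA0 h))
    · rw [candidate_of_one_lt' h1 h]
      exact mul_nonneg (by linarith) (f_nonneg h0 (by simp))

lemma candidate_le_one {x A l : ℝ} (hx : x ∈ Icc (0 : ℝ) 1) (hA : A ∈ Icc (0 : ℝ) 2) :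
    candidate x A l ≤ 1 := by
  rcases le_or_gt l 0 with h0 | h0
  · rw [candidate_of_nonpos h0]
  rcases le_or_gt l 1 with h1 | h1
  · have hl : l ∈ Ioc (0 : ℝ) 1 := ⟨h0, h1⟩
    rcases region_cases (x := x) (A := A) hl with ⟨a, b⟩ | ⟨a, b⟩ | ⟨a, b, d⟩ | a
    · rw [candidate_upper hl hx hA a b]
    · rwa [candidate_lower hl hx hA a b]
    · rw [candidate_middle hl a b d]
      have : 2 * x / l ≤ 3 - A := by
        rw [div_le_iff₀ h0]
        linarith
      linarith
    · linarith [candidate_left_le_half hl hx hA a.le, hA.2]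
  · linarith [candidate_le_half h1 hx hA, hA.2]

lemma candidate_le_height {x A l : ℝ} (h0 : 0 < l) (hx : x ∈ Icc (0 : ℝ) 1) (hA : A ∈ Icc (0 : ℝ) 2) :
    candidate x A l ≤ A := by
  rcases le_or_gt l 1 with h1 | h1
  · have hl : l ∈ Ioc (0 : ℝ) 1 := ⟨h0, h1⟩
    rcases region_cases (x := x) (A := A) hl with ⟨a, b⟩ | ⟨a, b⟩ | ⟨a, b, d⟩ | a
    · rwa [candidate_upper hl hx hA a b]
    · rw [candidate_lower hl hx hA a b]
    · rw [candidate_middle hl a b d]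
      have : 2 * x / l ≤ 2 * A := by
        rw [div_le_iff₀ h0]
        linarith
      linarith
    · linarith [candidate_left_le_half hl hx hA a.le, hA.1]
  · linarith [candidate_le_half h1 hx hA, hA.1]

lemma isTop_zero {l : ℝ} (hl : l ∈ Ioc (0 : ℝ) 1) : IsTop 0 l :=
  ⟨hl.1, by simp; linarith [hl.2], Or.inl rfl⟩

/-! ### Supporting planes and concavity of the explicit function. -/

lemma candidate_left_le_chord {x A l : ℝ} (hl : l ∈ Ioc (0 : ℝ) 1) (hx : x ∈ Icc (0 : ℝ) 1)
    (hA : A ∈ Icc (0 : ℝ) 2) (h : 4 * x ≤ l * A) (m : ℕ) :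
    candidate x A l ≤ slope m l * x + (1 / 2 ^ m - slope m l * alp m l) / 2 * A := by
  rw [candidate_left hl hA h]
  refine homogeneous_le hx.1 hA.1 (two_mul_le_of_left hl hA.1 h) fun y hy => ?_
  refine (f_le_chord (isTop_zero hl) m.zero_le hy).trans_eq ?_
  rw [chord]
  ring

lemma candidate_le_middle {x A l : ℝ} (hl : l ∈ Ioc (0 : ℝ) 1) (hx : x ∈ Icc (0 : ℝ) 1)
    (hA : A ∈ Icc (0 : ℝ) 2) : candidate x A l ≤ (A + 2 * x / l) / 3 := by
  have h0 := hl.1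
  rcases region_cases (x := x) (A := A) hl with ⟨a, b⟩ | ⟨a, b⟩ | ⟨a, b, d⟩ | a
  · rw [candidate_upper hl hx hA a b]
    have : 3 - A ≤ 2 * x / l := by
      rw [le_div_iff₀ h0]
      linarith
    linarith
  · rw [candidate_lower hl hx hA a b]
    have : 2 * A ≤ 2 * x / l := by
      rw [le_div_iff₀ h0]
      linarith
    linarith
  · rw [candidate_middle hl a b d]
  · refine (candidate_left_le_chord hl hx hA a.le 0).trans ?_
    rw [slope_zero h0 (by linarith [hl.2]), alp_zero h0.le (by linarith [hl.2])]
    have h1 : x / l ≤ A / 4 := by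
      rw [div_le_iff₀ h0]
      linarith
    have e1 : 5 / (3 * l) * x + (1 / 2 ^ 0 - 5 / (3 * l) * (l / 2)) / 2 * A =
        5 / 3 * (x / l) + A / 12 := by
      field_simp
      ring
    rw [e1, mul_div_assoc]
    linarith

/-- On the line `4 * x = l * A` the plane of the middle triangle equals `A / 2` and the homogenised
chord is at least that. To the right the chord has `x`-slope at least `5 / (3 * l)`, against `2 / (3
* l)` for the plane. -/
lemma candidate_le_chord {x A l : ℝ} (hl : l ∈ Ioc (0 : ℝ) 1) (hx : x ∈ Icc (0 : ℝ) 1)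
    (hA : A ∈ Icc (0 : ℝ) 2) (m : ℕ) :
    candidate x A l ≤ slope m l * x + (1 / 2 ^ m - slope m l * alp m l) / 2 * A := by
  have h0 := hl.1
  have hl2 : l ≤ (0 : ℕ) + 2 := by simp; linarith [hl.2]
  rcases le_or_gt (4 * x) (l * A) with a | a
  · exact candidate_left_le_chord hl hx hA a m
  · refine (candidate_le_middle hl hx hA).trans ?_
    have h1 := slope_mono m.zero_le h0 hl2
    rw [slope_zero h0 (by linarith [hl.2])] at h1
    have h2 := chord_le_of_alp_le m.zero_le h0 hl2 (x := l / 2)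
      (by rw [alp_one h0.le (by linarith [hl.2])]; linarith)
    rw [chord, alp_zero h0.le (by linarith [hl.2]), sub_self, mul_zero, add_zero, pow_zero, chord] at h2
    have h3 : 0 ≤ x / l - A / 4 := by
      rw [sub_nonneg, le_div_iff₀ h0]
      linarith
    have h4 : 5 / 3 * (x / l - A / 4) ≤ slope m l * (x - l * A / 4) := by
      have := mul_le_mul_of_nonneg_right h1 (show 0 ≤ x - l * A / 4 by linarith)
      refine le_trans (le_of_eq ?_) this
      field_simp
    have h5 := mul_le_mul_of_nonneg_right h2 hA.1
    rw [mul_div_assoc]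
    linarith

lemma candidate_zero {A l : ℝ} (h0 : 0 < l) (hA : A ∈ Icc (0 : ℝ) 2) : candidate 0 A l = 0 := by
  rcases le_or_gt l 1 with h1 | h1
  · rw [candidate_left ⟨h0, h1⟩ hA (by have := hA.1; simp; positivity)]
    simp [f_zero]
  · rw [candidate_of_one_lt h1 (by simpa using hA.1)]
    simp [f_zero]

/-- The explicit function is a lower envelope of linear functions, nondecreasing in `A`. -/
lemma candidate_support {x A l : ℝ} (h0 : 0 < l) (hx : x ∈ Ioc (0 : ℝ) 1) (hA : A ∈ Icc (0 : ℝ) 2) :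
    ∃ p q r, 0 ≤ q ∧ candidate x A l = p * x + q * A + r ∧
      ∀ y ∈ Icc (0 : ℝ) 1, ∀ B ∈ Icc (0 : ℝ) 2, candidate y B l ≤ p * y + q * B + r := by
  have hx' := Ioc_subset_Icc_self hx
  rcases le_or_gt l 1 with h1 | h1
  · have hl : l ∈ Ioc (0 : ℝ) 1 := ⟨h0, h1⟩
    rcases region_cases (x := x) (A := A) hl with ⟨a, b⟩ | ⟨a, b⟩ | ⟨a, b, d⟩ | a
    · exact ⟨0, 0, 1, le_rfl, by simp [candidate_upper hl hx' hA a b],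
        fun y hy B hB => by simpa using candidate_le_one hy hB⟩
    · exact ⟨0, 1, 0, zero_le_one, by simp [candidate_lower hl hx' hA a b],
        fun y hy B hB => by simpa using candidate_le_height h0 hy hB⟩
    · refine ⟨2 / (3 * l), 1 / 3, 0, by norm_num, ?_, fun y hy B hB =>
        (candidate_le_middle hl hy hB).trans_eq ?_⟩
      · rw [candidate_middle hl a b d]
        field_simp
        ring
      · field_simp
        ring
    · have h2 := two_mul_le_of_left hl hA.1 a.le
      have hA0 : 0 < A := by linarith [hx.1]
      have hr : 2 * x / A ∈ Ioc (0 : ℝ) 1 := ⟨div_pos (by linarith [hx.1]) hA0,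
        div_le_one_of_le₀ h2 hA0.le⟩
      rcases f_cases (isTop_zero hl) hr with ⟨h3, -⟩ | ⟨m, -, -, -, h3⟩
      · rw [curve_zero (Ioc_subset_Icc_self hr), ← mul_div_assoc, le_div_iff₀ hA0] at h3
        linarith
      · refine ⟨slope m l, (1 / 2 ^ m - slope m l * alp m l) / 2, 0, ?_, ?_, fun y hy B hB => ?_⟩
        · have hl2 : l ≤ (m : ℝ) + 2 := by linarith [m.cast_nonneg (α := ℝ)]
          have := chord_zero_nonneg h0 hl2
          rw [chord] at this
          linarith
        · rw [candidate_left hl hA a.le, add_zero]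
          exact homogeneous_eq hx.1.le h2 (by rw [h3, chord]; ring)
        · rw [add_zero]
          exact candidate_le_chord hl hy hB m
  · rcases le_or_gt (2 * x) A with h | h
    · have hA0 : 0 < A := by linarith [hx.1]
      have hr : 2 * x / A ∈ Ioc (0 : ℝ) 1 := ⟨div_pos (by linarith [hx.1]) hA0,
        div_le_one_of_le₀ h hA0.le⟩
      obtain ⟨p, r, hp, h2, h3⟩ := f_support h0 hr
      refine ⟨p, r / 2, 0, ?_, ?_, fun y hy B hB => ?_⟩
      · have := h3 0 (by simp)
        rw [f_zero] at this
        linarith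
      · rw [candidate_of_one_lt h1 h, add_zero]
        exact homogeneous_eq hx.1.le h h2
      · rw [add_zero]
        rcases le_total (2 * y) B with h4 | h4
        · rw [candidate_of_one_lt h1 h4]
          exact homogeneous_le hy.1 hB.1 h4 h3
        · rw [candidate_of_one_lt' h1 h4]
          have h5 := mul_le_mul_of_nonneg_left (h3 1 (by simp)) (show 0 ≤ B / 2 by linarith [hB.1])
          nlinarith
    · have hf := f_nonneg h0 (show (1 : ℝ) ∈ Icc (0 : ℝ) 1 by simp)
      refine ⟨0, f 1 l / 2, 0, by linarith, ?_, fun y hy B hB => ?_⟩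
      · rw [candidate_of_one_lt' h1 h.le]
        ring
      · refine (candidate_le_half_f_one h1 hy hB).trans_eq ?_
        ring

lemma candidate_midpoint (x : ℝ) (hx : x ∈ Icc (0 : ℝ) 1) (y : ℝ) (hy : y ∈ Icc (0 : ℝ) 1) (A : ℝ)
    (hA : A ∈ Icc (0 : ℝ) 2) (B : ℝ) (hB : B ∈ Icc (0 : ℝ) 2) (l : ℝ) :
    (candidate x A l + candidate y B l) / 2 ≤ candidate ((x + y) / 2) ((A + B) / 2) l := by
  have hm : (A + B) / 2 ∈ Icc (0 : ℝ) 2 := ⟨by linarith [hA.1, hB.1], by linarith [hA.2, hB.2]⟩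
  rcases le_or_gt l 0 with h0 | h0
  · simp [candidate_of_nonpos h0]
  rcases (add_nonneg hx.1 hy.1).eq_or_lt with h | h
  · obtain rfl : x = 0 := by linarith [hx.1, hy.1]
    obtain rfl : y = 0 := by linarith
    simp [candidate_zero h0 hA, candidate_zero h0 hB, candidate_zero h0 hm]
  · obtain ⟨p, q, r, -, h1, h2⟩ := candidate_support h0
      (show (x + y) / 2 ∈ Ioc (0 : ℝ) 1 from ⟨by linarith, by linarith [hx.2, hy.2]⟩) hm
    rw [h1]
    linarith [h2 x hx A hA, h2 y hy B hB]

lemma candidate_mono_height {x A B l : ℝ} (h0 : 0 < l) (hx : x ∈ Icc (0 : ℝ) 1)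
    (hA : A ∈ Icc (0 : ℝ) 2) (hB : B ∈ Icc (0 : ℝ) 2) (hAB : A ≤ B) :
    candidate x A l ≤ candidate x B l := by
  rcases hx.1.eq_or_lt with rfl | hx0
  · rw [candidate_zero h0 hA, candidate_zero h0 hB]
  · obtain ⟨p, q, r, hq, h1, h2⟩ := candidate_support h0 ⟨hx0, hx.2⟩ hB
    rw [h1]
    refine (h2 x hx A hA).trans ?_
    have := mul_le_mul_of_nonneg_left hAB hq
    linarith

/-! ### The jump inequality for the explicit function. -/

lemma candidate_smul {u s μ : ℝ} (h0 : 0 < μ) (hu : u ∈ Icc (0 : ℝ) 1) (hs : s ∈ Ioc (0 : ℝ) 1) :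
    candidate (s * u) s μ = s * candidate u 1 μ := by
  have hs0 := hs.1
  have m1 : (1 : ℝ) ∈ Icc (0 : ℝ) 2 := by constructor <;> norm_num
  have ms : s ∈ Icc (0 : ℝ) 2 := ⟨hs0.le, by linarith [hs.2]⟩
  have mu : s * u ∈ Icc (0 : ℝ) 1 := ⟨mul_nonneg hs0.le hu.1, by nlinarith [hs.2, hu.1, hu.2]⟩
  have e : 2 * (s * u) / s = 2 * u / 1 := by field_simp
  rcases le_or_gt μ 1 with h1 | h1
  · have hl : μ ∈ Ioc (0 : ℝ) 1 := ⟨h0, h1⟩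
    rcases le_total μ u with h2 | h2
    · rw [candidate_lower hl hu m1 le_rfl (by linarith), candidate_lower hl mu ms hs.2 (by nlinarith),
        mul_one]
    rcases le_total μ (4 * u) with h3 | h3
    · rw [candidate_middle hl (by nlinarith) (by nlinarith) (by nlinarith [hs.2]),
        candidate_middle hl (by linarith) (by linarith) (by linarith)]
      field_simp
    · rw [candidate_left hl m1 (by linarith), candidate_left hl ms (by nlinarith), e]
      ring
  · rcases le_total (2 * u) 1 with h2 | h2
    · rw [candidate_of_one_lt h1 h2, candidate_of_one_lt h1 (by nlinarith), e]
      ring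
    · rw [candidate_of_one_lt' h1 h2, candidate_of_one_lt' h1 (by nlinarith)]
      ring

lemma candidate_height_one_antitone {u μ μ' : ℝ} (hu : u ∈ Icc (0 : ℝ) 1) (h : μ ≤ μ') :
    candidate u 1 μ' ≤ candidate u 1 μ := by
  have m1 : (1 : ℝ) ∈ Icc (0 : ℝ) 2 := by constructor <;> norm_num
  rcases le_or_gt μ 0 with h0 | h0
  · rw [candidate_of_nonpos h0]
    exact candidate_le_one hu m1
  have left : ∀ ν, 0 < ν → 2 * u ≤ 1 → (1 < ν ∨ 4 * u ≤ ν) → candidate u 1 ν = 1 / 2 * f (2 * u) ν := by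
    intro ν hν h2 h3
    rcases le_or_gt ν 1 with h1 | h1
    · rw [candidate_left ⟨hν, h1⟩ m1 (by rcases h3 with h3 | h3 <;> linarith), div_one]
    · rw [candidate_of_one_lt h1 h2, div_one]
  rcases le_or_gt μ 1 with h1 | h1
  · have hl : μ ∈ Ioc (0 : ℝ) 1 := ⟨h0, h1⟩
    rcases le_total μ u with h2 | h2
    · rw [candidate_lower hl hu m1 le_rfl (by linarith)]
      exact candidate_le_one hu m1
    rcases le_total μ (4 * u) with h3 | h3
    · rw [candidate_middle hl (by linarith) (by linarith) (by linarith)]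
      rcases le_or_gt μ' 1 with h1' | h1'
      · refine (candidate_le_middle ⟨h0.trans_le h, h1'⟩ hu m1).trans ?_
        have := hu.1
        gcongr
      · refine (candidate_le_half h1' hu m1).trans ?_
        have : 1 / 2 ≤ 2 * u / μ := by
          rw [le_div_iff₀ h0]
          linarith
        linarith
    · rw [left μ h0 (by linarith) (Or.inr h3), left μ' (by linarith) (by linarith)
        (Or.inr (by linarith))]
      have := f_antitone h0 h (x := 2 * u) ⟨by linarith [hu.1], by linarith⟩
      linarith
  · have h1' : 1 < μ' := h1.trans_le h
    rcases le_total (2 * u) 1 with h2 | h2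
    · rw [left μ h0 h2 (Or.inl h1), left μ' (by linarith) h2 (Or.inl h1')]
      have := f_antitone h0 h (x := 2 * u) ⟨by linarith [hu.1], by linarith⟩
      linarith
    · rw [candidate_of_one_lt' h1 h2, candidate_of_one_lt' h1' h2]
      have := f_antitone h0 h (x := 1) (by simp)
      linarith

lemma candidate_height_one_le_f {u l : ℝ} (hu : u ∈ Icc (0 : ℝ) 1) (h0 : 0 < l) :
    candidate u 1 (l - u) ≤ f u l := by
  have m1 : (1 : ℝ) ∈ Icc (0 : ℝ) 2 := by constructor <;> norm_num
  rcases hu.1.eq_or_lt with rfl | hu0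
  · rw [sub_zero, candidate_zero h0 m1, f_zero]
  have hu' : u ∈ Ioc (0 : ℝ) 1 := ⟨hu0, hu.2⟩
  rcases le_or_gt l (2 * u) with h1 | h1
  · rw [f_of_le_two_mul h0 hu' h1]
    exact candidate_le_one hu m1
  obtain ⟨μ, rfl⟩ : ∃ μ, l = μ + u := ⟨l - u, by ring⟩
  rw [add_sub_cancel_right]
  have hμ : 0 < μ := by linarith
  rcases le_or_gt μ 1 with h2 | h2
  · have hl : μ ∈ Ioc (0 : ℝ) 1 := ⟨hμ, h2⟩
    rcases le_total μ (4 * u) with h3 | h3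
    · rw [candidate_middle hl (by linarith) (by linarith) (by linarith)]
      exact le_f_low hu' (by linarith) h2 h3
    · rw [candidate_left hl m1 (by linarith), div_one]
      linarith [half_f_two_mul_le hu0 (by linarith) hμ]
  · rcases le_total (2 * u) 1 with h3 | h3
    · rw [candidate_of_one_lt h2 h3, div_one]
      linarith [half_f_two_mul_le hu0 (by linarith) hμ]
    · rw [candidate_of_one_lt' h2 h3]
      linarith [half_f_one_le (by linarith) hu.2 hμ]

/-- Reduction to height `2`: raise `A - 1` to `A / 2`, scale to height `1` at `u = 2 * x / A`, and
lower the level from `l - x` to `l - u`, which is legitimate since `x ≤ u`. -/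
lemma candidate_jump_of_homogeneous {x A l : ℝ} (hx : x ∈ Icc (0 : ℝ) 1) (hA : A ∈ Icc (1 : ℝ) 2)
    (hxl : x < l) (h : 2 * x ≤ A) : candidate x (A - 1) (l - x) ≤ A / 2 * f (2 * x / A) l := by
  have hA0 : 0 < A := by linarith [hA.1]
  have hl : 0 < l := hx.1.trans_lt hxl
  have hu := ratio_mem hx.1 hA0.le h
  have e := mul_ratio hx.1 h
  have hux : x ≤ 2 * x / A := by
    rw [le_div_iff₀ hA0]
    nlinarith [hx.1, hA.2]
  have hμ : 0 < l - x := by linarith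
  have h1 := candidate_height_one_le_f hu hl
  have h2 := candidate_height_one_antitone hu (show l - 2 * x / A ≤ l - x by linarith)
  have h3 := candidate_smul hμ hu (s := A / 2) ⟨by linarith, by linarith [hA.2]⟩
  rw [e] at h3
  have h4 := candidate_mono_height hμ hx (A := A - 1) (B := A / 2)
    ⟨by linarith [hA.1], by linarith [hA.2]⟩ ⟨by linarith, by linarith [hA.2]⟩ (by linarith [hA.2])
  refine h4.trans ?_
  rw [h3]
  exact mul_le_mul_of_nonneg_left (h2.trans h1) (by linarith)

lemma candidate_jump (x : ℝ) (hx : x ∈ Icc (0 : ℝ) 1) (A : ℝ) (hA : A ∈ Icc (1 : ℝ) 2) (l : ℝ) :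
    candidate x (A - 1) (l - x) ≤ candidate x A l := by
  have hA' : A ∈ Icc (0 : ℝ) 2 := ⟨by linarith [hA.1], hA.2⟩
  have hA1 : A - 1 ∈ Icc (0 : ℝ) 2 := ⟨by linarith [hA.1], by linarith [hA.2]⟩
  have hA2 := hA.2
  have hA3 := hA.1
  rcases le_or_gt l 0 with h0 | h0
  · rw [candidate_of_nonpos h0]
    exact candidate_le_one hx hA1
  rcases le_or_gt l 1 with h1 | h1
  · have hl : l ∈ Ioc (0 : ℝ) 1 := ⟨h0, h1⟩
    rcases le_or_gt (3 * l) (2 * x + l * A) with h2 | h2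
    · rw [candidate_upper hl hx hA' hA.1 h2]
      exact candidate_le_one hx hA1
    have hxl : x < l := by nlinarith
    rcases le_or_gt (l * A) (4 * x) with h3 | h3
    · have hxA : x ≤ l * A := by nlinarith
      rw [candidate_middle hl hxA h3 h2.le]
      refine (candidate_le_height (by linarith) hx hA1).trans ?_
      have : A / 2 ≤ 2 * x / l := by
        rw [le_div_iff₀ h0]
        linarith
      linarith
    · rw [candidate_left hl hA' h3.le]
      exact candidate_jump_of_homogeneous hx hA hxl (two_mul_le_of_left hl hA'.1 h3.le)
  · rcases le_or_gt (2 * x) A with h2 | h2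
    · rw [candidate_of_one_lt h1 h2]
      exact candidate_jump_of_homogeneous hx hA (by linarith [hx.2]) h2
    · rw [candidate_of_one_lt' h1 h2.le]
      have m1 : (1 : ℝ) ∈ Icc (0 : ℝ) 1 := by simp
      have e1 := candidate_height_one_le_f m1 h0
      have e2 := candidate_height_one_antitone m1 (show l - 1 ≤ l - x by linarith [hx.2])
      have e3 := candidate_nonneg (l := l - x) m1 (show (1 : ℝ) ∈ Icc (0 : ℝ) 2 by
        constructor <;> norm_num)
      -- Moving to `x = 1` allows the jump at height `2` to be used there; afterwards `A - 1 ≤ A /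
      -- 2` suffices.
      have e4 : candidate x (A - 1) (l - x) ≤ (A - 1) * candidate 1 1 (l - x) := by
        rcases le_or_gt (l - x) 1 with h3 | h3
        · have hμ : 0 < l - x := by linarith [hx.2]
          rw [candidate_lower ⟨hμ, h3⟩ m1 (by constructor <;> norm_num) le_rfl (by linarith), mul_one]
          exact candidate_le_height hμ hx hA1
        · rw [candidate_of_one_lt' (x := 1) (A := 1) h3 (by norm_num)]
          refine (candidate_le_half_f_one h3 hx hA1).trans_eq ?_
          ring
      refine e4.trans ?_
      nlinarith

/-! ### Left semicontinuity in the level, and the upper bound. -/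

lemma eventually_candidate_le {x A l ε : ℝ} (h0 : 0 < l) (hx : x ∈ Icc (0 : ℝ) 1)
    (hA : A ∈ Icc (0 : ℝ) 2) (hε : 0 < ε) :
    ∀ᶠ l' in nhdsWithin l (Iio l), candidate x A l' ≤ candidate x A l + ε := by
  have gt : ∀ c < l, ∀ᶠ l' in nhdsWithin l (Iio l), c < l' := fun c hc =>
    Filter.Eventually.filter_mono nhdsWithin_le_nhds (eventually_gt_nhds hc)
  have scale : ∀ {y l'}, f y l' ≤ f y l + ε → A / 2 * f y l' ≤ A / 2 * f y l + ε := by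
    intro y l' h
    have := mul_le_mul_of_nonneg_left h (show 0 ≤ A / 2 by linarith [hA.1])
    nlinarith [hA.2]
  rcases le_or_gt l 1 with h1 | h1
  · have hl : l ∈ Ioc (0 : ℝ) 1 := ⟨h0, h1⟩
    rcases region_cases (x := x) (A := A) hl with ⟨a, b⟩ | ⟨a, b⟩ | ⟨a, b, d⟩ | a
    · rw [candidate_upper hl hx hA a b]
      exact Filter.Eventually.of_forall fun l' => by linarith [candidate_le_one (l := l') hx hA]
    · rw [candidate_lower hl hx hA a b]
      filter_upwards [gt 0 h0] with l' h2
      linarith [candidate_le_height h2 hx hA]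
    · rw [candidate_middle hl a b d]
      have t : Filter.Tendsto (fun l' => (A + 2 * x / l') / 3) (nhdsWithin l (Iio l))
          (nhds ((A + 2 * x / l) / 3)) := by
        have : ContinuousAt (fun l' => (A + 2 * x / l') / 3) l := by fun_prop (disch := exact h0.ne')
        exact this.tendsto.mono_left nhdsWithin_le_nhds
      filter_upwards [gt 0 h0, self_mem_nhdsWithin, t.eventually_lt_const
        (show (A + 2 * x / l) / 3 < (A + 2 * x / l) / 3 + ε by linarith)] with l' h2 h3 h4
      exact (candidate_le_middle ⟨h2, (le_of_lt h3).trans h1⟩ hx hA).trans h4.le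
    · have hA0 : 0 < A := by
        rcases hA.1.eq_or_lt with h | h
        · rw [← h] at a
          linarith [hx.1]
        · exact h
      have h2 : 4 * x / A < l := by
        rw [div_lt_iff₀ hA0]
        exact a
      rw [candidate_left hl hA a.le]
      filter_upwards [gt 0 h0, self_mem_nhdsWithin, gt _ h2, eventually_f_le h0
        (ratio_mem hx.1 hA.1 (two_mul_le_of_left hl hA.1 a.le)) hε] with l' h3 h4 h5 h6
      rw [div_lt_iff₀ hA0] at h5
      rw [candidate_left ⟨h3, (le_of_lt h4).trans h1⟩ hA h5.le]
      exact scale h6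
  · rcases le_or_gt (2 * x) A with h2 | h2
    · rw [candidate_of_one_lt h1 h2]
      filter_upwards [gt 1 h1, eventually_f_le h0 (ratio_mem hx.1 hA.1 h2) hε] with l' h3 h4
      rw [candidate_of_one_lt h3 h2]
      exact scale h4
    · rw [candidate_of_one_lt' h1 h2.le]
      filter_upwards [gt 1 h1, eventually_f_le h0 (show (1 : ℝ) ∈ Icc (0 : ℝ) 1 by simp) hε]
        with l' h3 h4
      rw [candidate_of_one_lt' h3 h2.le]
      exact scale h4

lemma le_candidate_of_mem_bellmanValues {x A l v : ℝ} (hx : x ∈ Icc (0 : ℝ) 1)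
    (hA : A ∈ Icc (0 : ℝ) 2) (hv : v ∈ bellmanValues x A l) : v ≤ candidate x A l := by
  refine le_of_mem_bellmanValues (fun x hx A hA l => candidate_nonneg hx hA)
    (fun x _ A _ l hl => candidate_of_nonpos hl) candidate_midpoint candidate_jump
    (fun x hx A hA l hl ε hε => ?_) hx hA hv
  obtain ⟨l', h1, h2⟩ := ((eventually_candidate_le hl hx hA hε).and self_mem_nhdsWithin).exists
  exact ⟨l', h2, h1⟩

/-! ### The lower bound. -/

lemma bellman_concave {x y A B l t : ℝ} (hx : x ∈ Icc (0 : ℝ) 1) (hy : y ∈ Icc (0 : ℝ) 1)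
    (hA : A ∈ Icc (0 : ℝ) 2) (hB : B ∈ Icc (0 : ℝ) 2) (ht : t ∈ Icc (0 : ℝ) 1) :
    (1 - t) * bellman x A l + t * bellman y B l ≤
      bellman ((1 - t) * x + t * y) ((1 - t) * A + t * B) l := by
  have mem : ∀ {a b c : ℝ}, a ∈ Icc (0 : ℝ) c → b ∈ Icc (0 : ℝ) c → ∀ s ∈ Icc (0 : ℝ) 1,
      (1 - s) * a + s * b ∈ Icc (0 : ℝ) c := fun ha hb s hs =>
    convex_Icc _ _ ha hb (sub_nonneg.2 hs.2) hs.1 (by ring)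
  have h := le_of_midpoint_concave
    (g := fun t => bellman ((1 - t) * x + t * y) ((1 - t) * A + t * B) l)
    (fun t _ => bellman_nonneg _ _ _) (fun s hs t ht => ?_) ht
  · simpa using h
  · refine (bellman_midpoint (mem hx hy s hs) (mem hx hy t ht) (mem hA hB s hs)
      (mem hA hB t ht)).trans (le_of_eq ?_)
    congr 1 <;> ring

lemma convexHull_subset_le_bellman {s : Set (ℝ × ℝ)} {l p q r : ℝ}
    (hs : ∀ z ∈ s, z.1 ∈ Icc (0 : ℝ) 1 ∧ z.2 ∈ Icc (0 : ℝ) 2 ∧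
      p * z.1 + q * z.2 + r ≤ bellman z.1 z.2 l)
    {x A : ℝ} (h : (x, A) ∈ convexHull ℝ s) : p * x + q * A + r ≤ bellman x A l := by
  have hC : Convex ℝ {z : ℝ × ℝ | z.1 ∈ Icc (0 : ℝ) 1 ∧ z.2 ∈ Icc (0 : ℝ) 2 ∧
      p * z.1 + q * z.2 + r ≤ bellman z.1 z.2 l} := by
    rintro z ⟨z1, z2, z3⟩ w ⟨w1, w2, w3⟩ a b ha hb hab
    obtain rfl : a = 1 - b := by linarith
    refine ⟨convex_Icc _ _ z1 w1 ha hb hab, convex_Icc _ _ z2 w2 ha hb hab, ?_⟩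
    refine le_trans ?_ (bellman_concave z1 w1 z2 w2 ⟨hb, by linarith⟩)
    have h1 := mul_le_mul_of_nonneg_left z3 ha
    have h2 := mul_le_mul_of_nonneg_left w3 hb
    simp only [Prod.fst_add, Prod.snd_add, Prod.smul_fst, Prod.smul_snd, smul_eq_mul]
    linarith
  exact (convexHull_min (t := {z : ℝ × ℝ | z.1 ∈ Icc (0 : ℝ) 1 ∧ z.2 ∈ Icc (0 : ℝ) 2 ∧
      p * z.1 + q * z.2 + r ≤ bellman z.1 z.2 l}) hs hC h).2.2

lemma one_le_bellman_of_le {x A l : ℝ} (hx : x ∈ Icc (0 : ℝ) 1) (hA : A ∈ Icc (1 : ℝ) 2)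
    (h : l ≤ x) : 1 ≤ bellman x A l := by
  refine le_trans (le_of_eq ?_) (bellman_jump hx hA)
  rw [bellman_of_nonpos hx ⟨by linarith [hA.1], by linarith [hA.2]⟩ (by linarith)]

lemma bellman_one_le_two {x l : ℝ} (hx : x ∈ Icc (0 : ℝ) 1) :
    bellman x 1 (l - x) ≤ bellman x 2 l := by
  have := bellman_jump (A := 2) (l := l) hx (by constructor <;> norm_num)
  norm_num at this
  exact this

lemma one_le_bellman_two {x l : ℝ} (hx : x ∈ Icc (0 : ℝ) 1) (h : l ≤ 2 * x) :
    1 ≤ bellman x 2 l :=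
  (one_le_bellman_of_le hx (by constructor <;> norm_num) (by linarith)).trans (bellman_one_le_two hx)

/-- All the height is concentrated, at its maximum `2`, with weight `A / 2`; the mass `y` put on the
rest is not exploited. -/
lemma half_mul_bellman_le {x y A l : ℝ} (hx : x ∈ Icc (0 : ℝ) 1) (hy : y ∈ Icc (0 : ℝ) 1)
    (hA : A ∈ Icc (0 : ℝ) 2) :
    A / 2 * bellman x 2 l ≤ bellman ((1 - A / 2) * y + A / 2 * x) A l := by
  have h := bellman_concave (l := l) (t := A / 2) hy hx (A := 0) (B := 2) (by simp) (by simp)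
    ⟨by linarith [hA.1], by linarith [hA.2]⟩
  have h1 := mul_nonneg (show 0 ≤ 1 - A / 2 by linarith [hA.2]) (bellman_nonneg y 0 l)
  rw [mul_zero, zero_add, div_mul_cancel₀ A two_ne_zero] at h
  linarith

lemma le_bellman_curve (m : ℕ) : ∀ {x : ℝ}, x ∈ Icc (0 : ℝ) 1 →
    1 / 2 ^ m ≤ bellman x 2 (curve m x) := by
  induction m with
  | zero =>
    intro x hx
    simpa using one_le_bellman_two hx (curve_zero hx).le
  | succ m ih =>
    intro x hx
    have m1 : (1 : ℝ) ∈ Icc (0 : ℝ) 2 := by constructor <;> norm_num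
    refine le_trans ?_ (bellman_one_le_two hx)
    rcases le_total x (1 / 2) with h | h
    · have h2 : 2 * x ∈ Icc (0 : ℝ) 1 := ⟨by linarith [hx.1], by linarith⟩
      have h3 := half_mul_bellman_le (l := curve m (2 * x)) h2 (y := 0) (by simp) m1
      rw [curve_succ, add_sub_cancel_right]
      rw [show (1 - 1 / 2) * 0 + 1 / 2 * (2 * x) = x by ring] at h3
      refine le_trans ?_ h3
      rw [pow_succ]
      have := ih h2
      rw [one_div_mul_eq_div]
      rw [← div_div]
      linarith
    -- Density `2 * x` would exceed `1`, so one half is filled completely and the surplus `2 * x -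
    -- 1` goes to the half of height `0`.
    · have h3 := half_mul_bellman_le (l := curve m 1) (x := 1) (by simp) (y := 2 * x - 1)
        ⟨by linarith, by linarith [hx.2]⟩ m1
      rw [curve_succ_of_ge m h hx.2, add_sub_cancel_right, ← curve_at_one]
      rw [show (1 - 1 / 2) * (2 * x - 1) + 1 / 2 * 1 = x by ring] at h3
      refine le_trans ?_ h3
      have := ih (x := 1) (by simp)
      rw [pow_succ, ← div_div]
      linarith

lemma f_le_bellman {x l : ℝ} (h0 : 0 < l) (hx : x ∈ Icc (0 : ℝ) 1) : f x l ≤ bellman x 2 l := by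
  rcases hx.1.eq_or_lt with rfl | hx0
  · rw [f_zero]
    exact bellman_nonneg _ _ _
  have m2 : (2 : ℝ) ∈ Icc (0 : ℝ) 2 := by simp
  have interp : ∀ {a b : ℝ}, a ∈ Icc (0 : ℝ) 1 → b ∈ Icc (0 : ℝ) 1 → ∀ {t : ℝ}, t ∈ Icc (0 : ℝ) 1 →
      (1 - t) * a + t * b = x → (1 - t) * bellman a 2 l + t * bellman b 2 l ≤ bellman x 2 l := by
    intro a b ha hb t ht h
    have := bellman_concave (l := l) ha hb m2 m2 ht
    rwa [h, show (1 - t) * 2 + t * 2 = (2 : ℝ) by ring] at this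
  have onCurve : ∀ {m : ℕ}, l ≤ m + 2 → 1 / 2 ^ m ≤ bellman (alp m l) 2 l := by
    intro m hm
    have := le_bellman_curve m (alp_mem m h0.le hm)
    rwa [curve_alp m h0.le hm] at this
  obtain ⟨M, hM⟩ := exists_isTop h0
  rcases f_cases hM ⟨hx0, hx.2⟩ with ⟨h1, h⟩ | ⟨m, hm, h1, h2, h⟩
  · have ha := alp_mem M h0.le hM.2.1
    have hax := (alp_le_iff M h0.le hM.2.1 hx).2 h1
    have e1 := onCurve hM.2.1
    have e2 : 1 / 2 ^ M ≤ bellman 1 2 l :=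
      (le_bellman_curve M (x := 1) (by simp)).trans
        (bellman_antitone (by rw [curve_at_one]; exact hM.2.1) (by simp) m2)
    rw [h]
    rcases hax.eq_or_lt with h3 | h3
    · rwa [h3] at e1
    · have hd : 0 < 1 - alp M l := by linarith [hx.2]
      have ht : (x - alp M l) / (1 - alp M l) ∈ Icc (0 : ℝ) 1 :=
        ⟨div_nonneg (by linarith) hd.le, div_le_one_of_le₀ (by linarith [hx.2]) hd.le⟩
      have := interp ha (show (1 : ℝ) ∈ Icc (0 : ℝ) 1 by simp) ht (by field_simp; ring)
      have e3 := mul_le_mul_of_nonneg_left e1 (sub_nonneg.2 ht.2)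
      have e4 := mul_le_mul_of_nonneg_left e2 ht.1
      linarith
  · have hl := hM.le_of_le hm
    have hl' : l ≤ ((m + 1 : ℕ) : ℝ) + 2 := by push_cast; linarith
    have h3 := (lt_alp_iff m h0.le hl hx).2 h1
    have h4 := (alp_le_iff (m + 1) h0.le hl' hx).2 h2
    have e1 := onCurve hl
    have e2 := onCurve hl'
    have hd : 0 < alp m l - alp (m + 1) l := by linarith
    have ht : (x - alp (m + 1) l) / (alp m l - alp (m + 1) l) ∈ Icc (0 : ℝ) 1 :=
      ⟨div_nonneg (by linarith) hd.le, div_le_one_of_le₀ (by linarith) hd.le⟩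
    have := interp (alp_mem (m + 1) h0.le hl') (alp_mem m h0.le hl) ht (by field_simp; ring)
    have e3 := mul_le_mul_of_nonneg_left e2 (sub_nonneg.2 ht.2)
    have e4 := mul_le_mul_of_nonneg_left e1 ht.1
    rw [h, chord_eq m h0 hl, slope]
    refine le_trans (le_of_eq ?_) ((add_le_add e3 e4).trans this)
    have e5 : (1 / 2 ^ m : ℝ) = 2 * (1 / 2 ^ (m + 1)) := by
      rw [pow_succ]
      field_simp
    rw [e5]
    field_simp
    ring

lemma homogeneous_le_bellman {x A l : ℝ} (h0 : 0 < l) (hx : x ∈ Icc (0 : ℝ) 1)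
    (hA : A ∈ Icc (0 : ℝ) 2) (h : 2 * x ≤ A) : A / 2 * f (2 * x / A) l ≤ bellman x A l := by
  have hr := ratio_mem hx.1 hA.1 h
  have h1 := half_mul_bellman_le (l := l) hr (y := 0) (by simp) hA
  rw [mul_zero, zero_add, mul_ratio hx.1 h] at h1
  exact (mul_le_mul_of_nonneg_left (f_le_bellman h0 hr) (by linarith [hA.1])).trans h1

lemma candidate_le_bellman {x A l : ℝ} (hx : x ∈ Icc (0 : ℝ) 1) (hA : A ∈ Icc (0 : ℝ) 2) :
    candidate x A l ≤ bellman x A l := by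
  rcases le_or_gt l 0 with h0 | h0
  · rw [candidate_of_nonpos h0, bellman_of_nonpos hx hA h0]
  rcases le_or_gt l 1 with h1 | h1
  · have hl : l ∈ Ioc (0 : ℝ) 1 := ⟨h0, h1⟩
    have m1 : (1 : ℝ) ∈ Icc (0 : ℝ) 1 := by simp
    have ml : l ∈ Icc (0 : ℝ) 1 := ⟨h0.le, h1⟩
    have ml2 : l / 2 ∈ Icc (0 : ℝ) 1 := ⟨by linarith, by linarith⟩
    have h12 : (1 : ℝ) ∈ Icc (1 : ℝ) 2 := by constructor <;> norm_num
    have e1 := one_le_bellman_two (l := l) ml2 (by linarith)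
    have e2 := one_le_bellman_of_le (l := l) ml h12 le_rfl
    have e3 := one_le_bellman_of_le (l := l) m1 h12 h1
    have e4 := one_le_bellman_two (l := l) m1 (by linarith)
    rcases region_cases (x := x) (A := A) hl with ⟨a, b⟩ | ⟨a, b⟩ | ⟨a, b, d⟩ | a
    · rw [candidate_upper hl hx hA a b]
      have := convexHull_subset_le_bellman (p := 0) (q := 0) (r := 1) (l := l) ?_
        ((mem_Sigma0'_iff hl).2 ⟨a, hA.2, hx.2, b⟩)
      · simpa using this
      · rintro z (rfl | rfl | rfl | rfl) <;> norm_num <;> (try refine ⟨⟨?_, ?_⟩, ?_⟩) <;>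
          first | assumption | linarith
    · rw [candidate_lower hl hx hA a b]
      have := convexHull_subset_le_bellman (p := 0) (q := 1) (r := 0) (l := l) ?_
        ((mem_Sigma1_iff hl).2 ⟨hA.1, a, hx.2, b⟩)
      · simpa using this
      · rintro z (rfl | rfl | rfl | rfl) <;> norm_num [bellman_nonneg] <;>
          (try refine ⟨⟨?_, ?_⟩, ?_⟩) <;> first | assumption | linarith
    · rw [candidate_middle hl a b d]
      have := convexHull_subset_le_bellman (p := 2 / (3 * l)) (q := 1 / 3) (r := 0) (l := l) ?_
        ((mem_Sigma0_iff hl).2 ⟨a, b, d⟩)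
      · refine le_trans (le_of_eq ?_) this
        field_simp
        ring
      · have r1 : 2 / (3 * l) * l = 2 / 3 := by field_simp
        have r2 : 2 / (3 * l) * (l / 2) = 1 / 3 := by field_simp
        rintro z (rfl | rfl | rfl)
        · simp [bellman_nonneg]
        · refine ⟨ml, by simp, ?_⟩
          simp only [r1]
          linarith
        · refine ⟨ml2, by simp, ?_⟩
          simp only [r2]
          linarith
    · rw [candidate_left hl hA a.le]
      exact homogeneous_le_bellman h0 hx hA (two_mul_le_of_left hl hA.1 a.le)
  · rcases le_or_gt (2 * x) A with h2 | h2
    · rw [candidate_of_one_lt h1 h2]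
      exact homogeneous_le_bellman h0 hx hA h2
    · rw [candidate_of_one_lt' h1 h2.le]
      have hd : 0 < 1 - A / 2 := by linarith [hx.2]
      -- The part of height `2` is filled; this `y` is the density left for the part of height `0`.
      have h3 := half_mul_bellman_le (l := l) (x := 1) (by simp) (y := (x - A / 2) / (1 - A / 2))
        ⟨div_nonneg (by linarith) hd.le, div_le_one_of_le₀ (by linarith [hx.2]) hd.le⟩ hA
      rw [mul_div_cancel₀ _ hd.ne', mul_one, sub_add_cancel] at h3
      exact (mul_le_mul_of_nonneg_left (f_le_bellman h0 (by simp)) (by linarith [hA.1])).trans h3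

end SparseBellman

end

/-- The first conjunct certifies that the real `sSup` is a true supremum and not a default value. -/
theorem theoremA (x A l : ℝ) (hx : x ∈ Set.Icc (0 : ℝ) 1) (hA : A ∈ Set.Icc (0 : ℝ) 2) :
    IsLUB (SparseBellman.bellmanValues x A l) (SparseBellman.bellman x A l) ∧
      SparseBellman.bellman x A l = SparseBellman.candidate x A l := by
  have hne := SparseBellman.bellmanValues_nonempty hx hA l
  refine ⟨isLUB_csSup hne (SparseBellman.bddAbove_bellmanValues x A l), le_antisymm ?_ ?_⟩
  · exact csSup_le hne fun v hv => SparseBellman.le_candidate_of_mem_bellmanValues hx hA hv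
  · exact SparseBellman.candidate_le_bellman hx hA
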